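/- Let $k$ be an algebraically closed field of characteristic $0$, let $\Gamma$ be a finite abelian group with character group $\hat\Gamma$, and let $V=\bigoplus_{i=1}^t kv_i$ ($t\ge 1$) be a quantum linear space over $\Gamma$: there are $g_i\in\Gamma$ and $\chi_i\in\hat\Gamma$ such that $v_i$ has coaction $v_i\mapsto g_i\otimes v_i$ and action $h\cdot v_i=\chi_i(h)v_i$ ($h\in\Gamma$), $\chi_i(g_i)$ is a primitive $r_i$-th root of unity with $r_i>1$, and $\chi_i(g_j)\chi_j(g_i)=1$ for $i\ne j$. Let $\mathcal B(V)\# k[\Gamma]$ be the Hopf algebra generated by the grouplikes $h\in\Gamma$ and the $(1,g_i)$-primitives $v_i$ (that is, $\Delta(v_i)=v_i\otimes 1+g_i\otimes v_i$) subject to the relations of $k[\Gamma]$ and $hv_i=\chi_i(h)v_ih$, $v_iv_j=\chi_j(g_i)v_jv_i$ ($i\neq j$), $v_i^{r_i}=0$; it is graded with $\Gamma$ in degree $0$ and the $v_i$ in degree $1$. Let $A$ be a finite dimensional Hopf algebra that is a lifting of $\mathcal B(V)\# k[\Gamma]$, i.e. the graded Hopf algebra $\operatorname{gr}A$ associated with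 the coradical filtration $A_0\subseteq A_1\subseteq\cdots$ of $A$ is isomorphic to $\mathcal B(V)\# k[\Gamma]$; identify $\Gamma$ with the group of grouplikes of $A$ accordingly, and let $x_i\in A_1$ be a lifting of $v_i$, i.e. $x_i$ is $(1,g_i)$-primitive, $hx_i=\chi_i(h)x_ih$ for $h\in\Gamma$, and the class of $x_i$ in $A_1/A_0$ is $v_i$. Suppose that the lifting matrix $(\alpha_{ij})$ of $A$ has $\alpha_{11}=1$ and all other entries $0$, i.e. $g_1^{r_1}\neq 1$, $\chi_1^{r_1}=1$, and $$x_1^{r_1}=g_1^{r_1}-1,\qquad x_j^{r_j}=0\ (2\le j\le t),\qquad x_ix_j=\chi_j(g_i)x_jx_i\ (i\ne j).$$ Let $\Omega=\{\gamma\in\hat\Gamma:\gamma(g_1^{r_1})=1\}$ and let $\Theta=\langle\chi_1\rangle\subseteq\Omega$ be the subgroup of $\hat\Gamma$ generated by $\chi_1$. Then, as coalgebras, the coradical of the dual Hopf algebra $A^*$ is $$\operatorname{corad}(A^*)\;\cong\; k[\Omega]\;\oplus\bigoplus_{\overline\gamma\in\hat\Gamma/\Theta,\ \gamma\notin\Omega}\mathcal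 M^c(r_1,k),$$ where $\mathcal M^c(r,k)$ is the $r\times r$ matrix coalgebra, with basis $e(i,j)$, $\Delta(e(i,j))=\sum_s e(i,s)\otimes e(s,j)$ and $\varepsilon(e(i,j))=\delta_{ij}$. -/

import Mathlib

open scoped TensorProduct

/-! ### Coalgebras: coradical, coradical filtration, matrix coalgebras, dual coalgebra -/

section Coalgebras

variable (k : Type*) [Field k] (C : Type*) [AddCommGroup C] [Module k C] [Coalgebra k C]

/-- A subspace `D` of a coalgebra `C` is a subcoalgebra if `Δ(D) ⊆ D ⊗ D`. -/
def IsSubcoalgebra (D : Submodule k C) : Prop :=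
  D.map (Coalgebra.comul (R := k) (A := C)) ≤
    LinearMap.range (TensorProduct.map D.subtype D.subtype)

/-- A subcoalgebra is simple if it is nonzero and has no subcoalgebras besides `0` and itself. -/
def IsSimpleSubcoalgebra (D : Submodule k C) : Prop :=
  IsSubcoalgebra k C D ∧ D ≠ ⊥ ∧ ∀ E : Submodule k C, IsSubcoalgebra k C E → E ≤ D → E = ⊥ ∨ E = D

/-- The coradical of a coalgebra: the sum of all its simple subcoalgebras. -/
def coradical : Submodule k C :=
  sSup {D | IsSimpleSubcoalgebra k C D}

/-- The coradical filtration: `C_0` is the coradical, and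
`C_{n+1} = Δ⁻¹(C ⊗ C_n + C_0 ⊗ C)`. -/
def coradicalFiltration : ℕ → Submodule k C
  | 0 => coradical k C
  | n + 1 =>
      (LinearMap.range
          (TensorProduct.map (LinearMap.id : C →ₗ[k] C) (coradicalFiltration n).subtype) ⊔
        LinearMap.range
          (TensorProduct.map (coradical k C).subtype (LinearMap.id : C →ₗ[k] C))).comap
        (Coalgebra.comul (R := k) (A := C))

end Coalgebras

section MatrixCoalgebra

/-- The underlying space of the `r × r` matrix coalgebra `M^c(r, k)`; its matrix coalgebra basis
`e(i, j)` consists of the matrix units. -/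
def MatrixCoalgebra (r : ℕ) (k : Type*) : Type _ := Matrix (Fin r) (Fin r) k

variable (r : ℕ) (k : Type*) [Field k]

instance : AddCommGroup (MatrixCoalgebra r k) :=
  inferInstanceAs (AddCommGroup (Matrix (Fin r) (Fin r) k))

instance : Module k (MatrixCoalgebra r k) :=
  inferInstanceAs (Module k (Matrix (Fin r) (Fin r) k))

/-- The matrix coalgebra basis `e(i, j)`, indexed by pairs `(i, j)`. -/
noncomputable def MatrixCoalgebra.basis :
    Module.Basis (Fin r × Fin r) k (MatrixCoalgebra r k) :=
  Matrix.stdBasis k (Fin r) (Fin r)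

/-- `Δ(e(i,j)) = ∑ s, e(i,s) ⊗ e(s,j)` and `ε(e(i,j)) = δ_{ij}`. -/
noncomputable instance : CoalgebraStruct k (MatrixCoalgebra r k) where
  comul := (MatrixCoalgebra.basis r k).constr k fun p =>
    ∑ s, MatrixCoalgebra.basis r k (p.1, s) ⊗ₜ[k] MatrixCoalgebra.basis r k (s, p.2)
  counit := (MatrixCoalgebra.basis r k).constr k fun p => if p.1 = p.2 then 1 else 0

theorem MatrixCoalgebra.comul_basis (i j : Fin r) :
    Coalgebra.comul (R := k) (MatrixCoalgebra.basis r k (i, j)) =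
      ∑ s, MatrixCoalgebra.basis r k (i, s) ⊗ₜ[k] MatrixCoalgebra.basis r k (s, j) :=
  (MatrixCoalgebra.basis r k).constr_basis k _ _

theorem MatrixCoalgebra.counit_basis (i j : Fin r) :
    Coalgebra.counit (R := k) (MatrixCoalgebra.basis r k (i, j)) = if i = j then 1 else 0 :=
  (MatrixCoalgebra.basis r k).constr_basis k _ _

noncomputable instance : Coalgebra k (MatrixCoalgebra r k) where
  coassoc := by
    refine (MatrixCoalgebra.basis r k).ext fun p => ?_
    obtain ⟨i, j⟩ := p
    simp only [LinearMap.comp_apply, LinearEquiv.coe_coe, MatrixCoalgebra.comul_basis, map_sum,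
      LinearMap.rTensor_tmul, LinearMap.lTensor_tmul, TensorProduct.sum_tmul,
      TensorProduct.tmul_sum, TensorProduct.assoc_tmul]
    exact Finset.sum_comm
  rTensor_counit_comp_comul := by
    refine (MatrixCoalgebra.basis r k).ext fun p => ?_
    obtain ⟨i, j⟩ := p
    simp [MatrixCoalgebra.comul_basis, MatrixCoalgebra.counit_basis, TensorProduct.ite_tmul]
  lTensor_counit_comp_comul := by
    refine (MatrixCoalgebra.basis r k).ext fun p => ?_
    obtain ⟨i, j⟩ := p
    simp [MatrixCoalgebra.comul_basis, MatrixCoalgebra.counit_basis, TensorProduct.tmul_ite]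

end MatrixCoalgebra

section DualCoalgebra

variable (k : Type*) [Field k] (A : Type*) [Ring A] [Algebra k A]

theorem dual_assoc_aux (S : Module.Dual k A ⊗[k] Module.Dual k A) (g : Module.Dual k A)
    (a b c : A) :
    TensorProduct.dualDistrib k A (A ⊗[k] A)
        ((TensorProduct.dualDistrib k A A).lTensor _
          (TensorProduct.assoc k _ _ _ (S ⊗ₜ g))) (a ⊗ₜ (b ⊗ₜ c)) =
      TensorProduct.dualDistrib k A A S (a ⊗ₜ b) * g c := by
  induction S with
  | zero => simp
  | tmul x y => simp [mul_assoc]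
  | add x y hx hy => simp only [TensorProduct.add_tmul, map_add, LinearMap.add_apply, hx, hy, add_mul]

variable [FiniteDimensional k A]

/-- The dual `A^*` of a finite dimensional algebra: `Δ(f) ∈ A^* ⊗ A^*` is the element that
corresponds to `a ⊗ b ↦ f(ab)` under `A^* ⊗ A^* ≅ (A ⊗ A)^*`, and `ε(f) = f(1)`. -/
noncomputable instance : CoalgebraStruct k (Module.Dual k A) where
  comul := (TensorProduct.dualDistribEquiv k A A).symm.toLinearMap ∘ₗ
    (LinearMap.mul' k A).dualMap
  counit := Module.Dual.eval k A 1

theorem dual_counit_apply (f : Module.Dual k A) : Coalgebra.counit (R := k) f = f 1 := rfl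

theorem dual_dualDistrib_comul (f : Module.Dual k A) :
    TensorProduct.dualDistrib k A A (Coalgebra.comul (R := k) f) = f ∘ₗ LinearMap.mul' k A :=
  (TensorProduct.dualDistribEquiv k A A).apply_symm_apply _

theorem dual_dualDistrib_injective (M N : Type*) [AddCommGroup M] [Module k M]
    [AddCommGroup N] [Module k N] [FiniteDimensional k M] [FiniteDimensional k N] :
    Function.Injective (TensorProduct.dualDistrib k M N) :=
  (TensorProduct.dualDistribEquiv k M N).injective

theorem dual_rTensor_aux (T : Module.Dual k A ⊗[k] Module.Dual k A) (a b c : A) :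
    TensorProduct.dualDistrib k A (A ⊗[k] A)
        ((TensorProduct.dualDistrib k A A).lTensor _
          (TensorProduct.assoc k _ _ _ ((Coalgebra.comul (R := k)).rTensor _ T)))
        (a ⊗ₜ (b ⊗ₜ c)) =
      TensorProduct.dualDistrib k A A T ((a * b) ⊗ₜ c) := by
  induction T with
  | zero => simp
  | tmul x y =>
    rw [LinearMap.rTensor_tmul, dual_assoc_aux, dual_dualDistrib_comul]
    simp
  | add x y hx hy => simp only [map_add, LinearMap.add_apply, hx, hy]

theorem dual_lTensor_aux (T : Module.Dual k A ⊗[k] Module.Dual k A) (a b c : A) :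
    TensorProduct.dualDistrib k A (A ⊗[k] A)
        ((TensorProduct.dualDistrib k A A).lTensor _
          ((Coalgebra.comul (R := k)).lTensor _ T)) (a ⊗ₜ (b ⊗ₜ c)) =
      TensorProduct.dualDistrib k A A T (a ⊗ₜ (b * c)) := by
  induction T with
  | zero => simp
  | tmul x y =>
    rw [LinearMap.lTensor_tmul, LinearMap.lTensor_tmul, dual_dualDistrib_comul]
    simp
  | add x y hx hy => simp only [map_add, LinearMap.add_apply, hx, hy]

theorem dual_rTensor_counit (T : Module.Dual k A ⊗[k] Module.Dual k A) (a : A) :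
    (TensorProduct.lid k _ ((Coalgebra.counit (R := k)).rTensor _ T) : Module.Dual k A) a =
      TensorProduct.dualDistrib k A A T (1 ⊗ₜ a) := by
  induction T with
  | zero => simp
  | tmul x y => simp [dual_counit_apply]
  | add x y hx hy => simp only [map_add, LinearMap.add_apply, hx, hy]

theorem dual_lTensor_counit (T : Module.Dual k A ⊗[k] Module.Dual k A) (a : A) :
    (TensorProduct.rid k _ ((Coalgebra.counit (R := k)).lTensor _ T) : Module.Dual k A) a =
      TensorProduct.dualDistrib k A A T (a ⊗ₜ 1) := by
  induction T with
  | zero => simp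
  | tmul x y => simp [dual_counit_apply, mul_comm]
  | add x y hx hy => simp only [map_add, LinearMap.add_apply, hx, hy]

noncomputable instance : Coalgebra k (Module.Dual k A) where
  coassoc := by
    refine LinearMap.ext fun f => ?_
    simp only [LinearMap.comp_apply, LinearEquiv.coe_coe]
    have hinj : Function.Injective ((TensorProduct.dualDistrib k A A).lTensor (Module.Dual k A)) :=
      Module.Flat.lTensor_preserves_injective_linearMap _ (dual_dualDistrib_injective k A A)
    apply hinj
    apply dual_dualDistrib_injective k A (A ⊗[k] A)
    refine TensorProduct.ext' fun a z => ?_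
    induction z with
    | zero => simp
    | add x y hx hy => simp only [TensorProduct.tmul_add, map_add, hx, hy]
    | tmul b c =>
      rw [dual_rTensor_aux, dual_lTensor_aux, dual_dualDistrib_comul]
      simp [mul_assoc]
  rTensor_counit_comp_comul := by
    refine LinearMap.ext fun f => (TensorProduct.lid k _).injective ?_
    refine LinearMap.ext fun a => ?_
    rw [LinearMap.comp_apply, dual_rTensor_counit, dual_dualDistrib_comul]
    simp
  lTensor_counit_comp_comul := by
    refine LinearMap.ext fun f => (TensorProduct.rid k _).injective ?_
    refine LinearMap.ext fun a => ?_
    rw [LinearMap.comp_apply, dual_lTensor_counit, dual_dualDistrib_comul]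
    simp

end DualCoalgebra

/-! ### The bosonization of a quantum linear space -/

/-- Gaussian binomial coefficients, through the `q`-Pascal rule. -/
def gaussBinom {k : Type*} [Field k] (q : k) : ℕ → ℕ → k
  | _, 0 => 1
  | 0, _ + 1 => 0
  | n + 1, j + 1 => gaussBinom q n j + q ^ (j + 1) * gaussBinom q n (j + 1)

theorem gaussBinom_absorb {k : Type*} [Field k] (q : k) (n : ℕ) : ∀ j,
    (1 - q ^ (j + 1)) * gaussBinom q (n + 1) (j + 1) = (1 - q ^ (n + 1)) * gaussBinom q n j := by
  induction n with
  | zero =>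
    intro j
    cases j <;> simp [gaussBinom]
  | succ n ih =>
    intro j
    have h1 : gaussBinom q (n + 1 + 1) (j + 1) =
      gaussBinom q (n + 1) j + q ^ (j + 1) * gaussBinom q (n + 1) (j + 1) := rfl
    rw [h1]
    cases j with
    | zero =>
      have := ih 0
      simp only [gaussBinom] at this ⊢
      linear_combination q * this
    | succ j =>
      have h2 : gaussBinom q (n + 1) (j + 1) =
        gaussBinom q n j + q ^ (j + 1) * gaussBinom q n (j + 1) := rfl
      have h3 := ih j
      have h4 := ih (j + 1)
      linear_combination q ^ (j + 2) * h4 - q * (1 - q ^ (n + 1)) * h2 + q * h3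

theorem gaussBinom_eq_zero_of_lt {k : Type*} [Field k] (q : k) (n : ℕ) : ∀ j, n < j →
    gaussBinom q n j = 0 := by
  induction n with
  | zero =>
    intro j hj
    obtain ⟨j, rfl⟩ := Nat.exists_eq_succ_of_ne_zero hj.ne'
    rfl
  | succ n ih =>
    intro j hj
    obtain ⟨j, rfl⟩ := Nat.exists_eq_succ_of_ne_zero (Nat.ne_zero_of_lt hj)
    simp only [gaussBinom]
    rw [ih j (by omega), ih (j + 1) (by omega)]
    simp

theorem add_pow_of_qcomm {k : Type*} [Field k] {R : Type*} [Ring R] [Algebra k R]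
    {q : k} {a b : R} (hab : b * a = q • (a * b)) (n : ℕ) :
    (a + b) ^ n = ∑ j ∈ Finset.range (n + 1), gaussBinom q n j • (a ^ j * b ^ (n - j)) := by
  have hb : ∀ j, b * a ^ j = q ^ j • (a ^ j * b) := by
    intro j
    induction j with
    | zero => simp
    | succ j ih =>
      rw [pow_succ, ← mul_assoc, ih, smul_mul_assoc, mul_assoc, hab, mul_smul_comm, smul_smul,
        mul_assoc, pow_succ]
  induction n with
  | zero => simp [gaussBinom]
  | succ n ih =>
    rw [pow_succ', ih, add_mul, Finset.mul_sum, Finset.mul_sum]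
    have e2 : ∑ j ∈ Finset.range (n + 1), b * gaussBinom q n j • (a ^ j * b ^ (n - j)) =
        ∑ j ∈ Finset.range (n + 2), (q ^ j * gaussBinom q n j) • (a ^ j * b ^ (n + 1 - j)) := by
      rw [Finset.sum_range_succ _ (n + 1), gaussBinom_eq_zero_of_lt q n (n + 1) (by omega)]
      simp only [mul_zero, zero_smul, add_zero]
      refine Finset.sum_congr rfl fun j hj => ?_
      have hj' : j ≤ n := by simpa [Nat.lt_succ_iff] using hj
      rw [mul_smul_comm, ← mul_assoc, hb, smul_mul_assoc, smul_smul, mul_assoc, ← pow_succ',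
        mul_comm, Nat.sub_add_comm hj']
    rw [e2, Finset.sum_range_succ' _ (n + 1), Finset.sum_range_succ' _ (n + 1), ← add_assoc,
      ← Finset.sum_add_distrib]
    congr 1
    · refine Finset.sum_congr rfl fun j hj => ?_
      have h1 : gaussBinom q (n + 1) (j + 1) =
        gaussBinom q n j + q ^ (j + 1) * gaussBinom q n (j + 1) := rfl
      rw [h1, add_smul, mul_smul_comm, ← mul_assoc, ← pow_succ', Nat.add_sub_add_right]
    · simp [gaussBinom]

/-- If `b a = q a b` with `q` a primitive `n`-th root of unity and `a ^ n = b ^ n = 0`, then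
`(a + b) ^ n = 0`. -/
theorem add_pow_eq_zero_of_qcomm {k : Type*} [Field k] {R : Type*} [Ring R] [Algebra k R]
    {q : k} {n : ℕ} (hn : 1 < n) (hq : IsPrimitiveRoot q n) {a b : R}
    (hab : b * a = q • (a * b)) (ha : a ^ n = 0) (hb : b ^ n = 0) : (a + b) ^ n = 0 := by
  rw [add_pow_of_qcomm hab]
  refine Finset.sum_eq_zero fun j hj => ?_
  have hj' : j ≤ n := by simpa [Nat.lt_succ_iff] using hj
  rcases Nat.eq_zero_or_pos j with rfl | h0
  · simp [hb]
  rcases hj'.eq_or_lt with rfl | hlt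
  · simp [ha]
  obtain ⟨j, rfl⟩ := Nat.exists_eq_succ_of_ne_zero h0.ne'
  obtain ⟨n, rfl⟩ := Nat.exists_eq_succ_of_ne_zero (Nat.ne_zero_of_lt hn)
  have h := gaussBinom_absorb q n j
  have h1 : q ^ (n + 1) = 1 := hq.pow_eq_one
  have h2 : 1 - q ^ (j + 1) ≠ 0 :=
    sub_ne_zero.mpr (hq.pow_ne_one_of_pos_of_lt (Nat.succ_ne_zero j) hlt).symm
  rw [h1, sub_self, zero_mul] at h
  rw [Nat.succ_eq_add_one, Nat.succ_eq_add_one, (mul_eq_zero.mp h).resolve_left h2, zero_smul]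

/-- The diagonal data of a quantum linear space `V = ⊕ k v_i` over the abelian group `Γ`,
with `v_i ∈ V_{g_i}^{χ_i}`: the group acts on `v_i` through the character `χ_i`, the coaction is
`v_i ↦ g_i ⊗ v_i`, `χ_i(g_i)` is a primitive `r_i`-th root of unity with `r_i > 1`, and
`χ_i(g_j) χ_j(g_i) = 1` for `i ≠ j`. -/
structure QuantumLinearSpace (k : Type*) [Field k] (Γ : Type*) [CommGroup Γ] (t : ℕ) where
  g : Fin t → Γ
  χ : Fin t → (Γ →* kˣ)
  r : Fin t → ℕ
  one_lt_r : ∀ i, 1 < r i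
  isPrimitiveRoot : ∀ i, IsPrimitiveRoot (χ i (g i)) (r i)
  braid : ∀ i j, i ≠ j → χ i (g j) * χ j (g i) = 1

namespace QuantumLinearSpace

variable {k : Type*} [Field k] {Γ : Type*} [CommGroup Γ] {t : ℕ}

/-- The free algebra on the symbols `h ∈ Γ` (`Sum.inl h`) and `v_i` (`Sum.inr i`). -/
abbrev Free (_V : QuantumLinearSpace k Γ t) : Type _ := FreeAlgebra k (Γ ⊕ Fin t)

/-- The defining relations of `B(V) # k[Γ]`: those of the group algebra `k[Γ]`,
`h v_i = χ_i(h) v_i h`, `v_i v_j = χ_j(g_i) v_j v_i` for `i ≠ j`, and `v_i ^ r_i = 0`. -/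
inductive Rel (V : QuantumLinearSpace k Γ t) : V.Free → V.Free → Prop
  | one : Rel V (FreeAlgebra.ι k (Sum.inl 1)) 1
  | mul (g h : Γ) : Rel V (FreeAlgebra.ι k (Sum.inl (g * h)))
      (FreeAlgebra.ι k (Sum.inl g) * FreeAlgebra.ι k (Sum.inl h))
  | act (h : Γ) (i : Fin t) :
      Rel V (FreeAlgebra.ι k (Sum.inl h) * FreeAlgebra.ι k (Sum.inr i))
        ((V.χ i h : k) • (FreeAlgebra.ι k (Sum.inr i) * FreeAlgebra.ι k (Sum.inl h)))
  | qcomm (i j : Fin t) (hij : i ≠ j) :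
      Rel V (FreeAlgebra.ι k (Sum.inr i) * FreeAlgebra.ι k (Sum.inr j))
        ((V.χ j (V.g i) : k) • (FreeAlgebra.ι k (Sum.inr j) * FreeAlgebra.ι k (Sum.inr i)))
  | nil (i : Fin t) : Rel V (FreeAlgebra.ι k (Sum.inr i) ^ V.r i) 0

/-- The algebra `B(V) # k[Γ]` (Nichols algebra of `V` bosonized by the group algebra). -/
def Bosonization (V : QuantumLinearSpace k Γ t) : Type _ := RingQuot V.Rel

variable (V : QuantumLinearSpace k Γ t)

noncomputable instance : Ring V.Bosonization := inferInstanceAs (Ring (RingQuot V.Rel))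

noncomputable instance : Algebra k V.Bosonization :=
  inferInstanceAs (Algebra k (RingQuot V.Rel))

/-- The quotient map from the free algebra. -/
noncomputable def quot : V.Free →ₐ[k] V.Bosonization := RingQuot.mkAlgHom k V.Rel

/-- The group element `h`, as an element of `B(V) # k[Γ]`. -/
noncomputable def grp (h : Γ) : V.Bosonization := V.quot (FreeAlgebra.ι k (Sum.inl h))

/-- The element `v_i = v_i # 1` of `B(V) # k[Γ]`. -/
noncomputable def v (i : Fin t) : V.Bosonization := V.quot (FreeAlgebra.ι k (Sum.inr i))

theorem quot_rel {a b : V.Free} (h : V.Rel a b) : V.quot a = V.quot b :=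
  RingQuot.mkAlgHom_rel k h

theorem grp_one : V.grp 1 = 1 := by
  rw [grp, V.quot_rel Rel.one, map_one]

theorem grp_mul (g h : Γ) : V.grp (g * h) = V.grp g * V.grp h := by
  rw [grp, V.quot_rel (Rel.mul g h), map_mul]; rfl

theorem grp_mul_v (h : Γ) (i : Fin t) : V.grp h * V.v i = (V.χ i h : k) • (V.v i * V.grp h) := by
  rw [grp, v, ← map_mul, V.quot_rel (Rel.act h i), map_smul, map_mul]

theorem v_mul_v (i j : Fin t) (hij : i ≠ j) :
    V.v i * V.v j = (V.χ j (V.g i) : k) • (V.v j * V.v i) := by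
  rw [v, v, ← map_mul, V.quot_rel (Rel.qcomm i j hij), map_smul, map_mul]

theorem v_pow (i : Fin t) : V.v i ^ V.r i = 0 := by
  rw [v, ← map_pow, V.quot_rel (Rel.nil i), map_zero]

section lift

variable {V} {B : Type*} [Ring B] [Algebra k B] (f : Γ → B) (x : Fin t → B)

/-- Algebra maps out of `B(V) # k[Γ]`. -/
noncomputable def lift (h1 : f 1 = 1) (hm : ∀ g h, f (g * h) = f g * f h)
    (ha : ∀ h i, f h * x i = (V.χ i h : k) • (x i * f h))
    (hq : ∀ i j, i ≠ j → x i * x j = (V.χ j (V.g i) : k) • (x j * x i))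
    (hn : ∀ i, x i ^ V.r i = 0) : V.Bosonization →ₐ[k] B :=
  RingQuot.liftAlgHom k ⟨FreeAlgebra.lift k (Sum.elim f x), by
    intro a b hab
    cases hab <;> simp [h1, hm, ha, hn]
    next i j hij => exact hq i j hij⟩

theorem lift_grp (h1 : f 1 = 1) (hm : ∀ g h, f (g * h) = f g * f h)
    (ha : ∀ h i, f h * x i = (V.χ i h : k) • (x i * f h))
    (hq : ∀ i j, i ≠ j → x i * x j = (V.χ j (V.g i) : k) • (x j * x i))
    (hn : ∀ i, x i ^ V.r i = 0) (h : Γ) :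
    lift f x h1 hm ha hq hn (V.grp h) = f h := by
  simp only [lift, grp, quot]
  erw [RingQuot.liftAlgHom_mkAlgHom_apply]
  simp

theorem lift_v (h1 : f 1 = 1) (hm : ∀ g h, f (g * h) = f g * f h)
    (ha : ∀ h i, f h * x i = (V.χ i h : k) • (x i * f h))
    (hq : ∀ i j, i ≠ j → x i * x j = (V.χ j (V.g i) : k) • (x j * x i))
    (hn : ∀ i, x i ^ V.r i = 0) (i : Fin t) :
    lift f x h1 hm ha hq hn (V.v i) = x i := by
  simp only [lift, v, quot]
  erw [RingQuot.liftAlgHom_mkAlgHom_apply]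
  simp

end lift

variable {V} in
theorem algHom_ext {B : Type*} [Ring B] [Algebra k B] {φ ψ : V.Bosonization →ₐ[k] B}
    (hg : ∀ h, φ (V.grp h) = ψ (V.grp h)) (hv : ∀ i, φ (V.v i) = ψ (V.v i)) : φ = ψ := by
  apply RingQuot.ringQuot_ext' k
  apply FreeAlgebra.hom_ext
  funext s
  rcases s with h | i
  · exact hg h
  · exact hv i

theorem grp_comm (g h : Γ) : V.grp g * V.grp h = V.grp h * V.grp g := by
  rw [← grp_mul, mul_comm, grp_mul]

theorem comul_one : V.grp 1 ⊗ₜ[k] V.grp 1 = 1 := by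
  rw [grp_one, Algebra.TensorProduct.one_def]

theorem comul_mul (g h : Γ) : V.grp (g * h) ⊗ₜ[k] V.grp (g * h) =
    (V.grp g ⊗ₜ[k] V.grp g) * (V.grp h ⊗ₜ[k] V.grp h) := by
  rw [grp_mul, Algebra.TensorProduct.tmul_mul_tmul]

theorem comul_act (h : Γ) (i : Fin t) :
    (V.grp h ⊗ₜ[k] V.grp h) * (V.v i ⊗ₜ[k] 1 + V.grp (V.g i) ⊗ₜ[k] V.v i) =
      (V.χ i h : k) •
        ((V.v i ⊗ₜ[k] 1 + V.grp (V.g i) ⊗ₜ[k] V.v i) * (V.grp h ⊗ₜ[k] V.grp h)) := by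
  simp only [mul_add, add_mul, Algebra.TensorProduct.tmul_mul_tmul, mul_one, one_mul, grp_mul_v,
    V.grp_comm h (V.g i), smul_add, TensorProduct.smul_tmul', TensorProduct.tmul_smul]

theorem comul_qcomm (i j : Fin t) (hij : i ≠ j) :
    (V.v i ⊗ₜ[k] 1 + V.grp (V.g i) ⊗ₜ[k] V.v i) * (V.v j ⊗ₜ[k] 1 + V.grp (V.g j) ⊗ₜ[k] V.v j) =
      (V.χ j (V.g i) : k) •
        ((V.v j ⊗ₜ[k] 1 + V.grp (V.g j) ⊗ₜ[k] V.v j) *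
          (V.v i ⊗ₜ[k] 1 + V.grp (V.g i) ⊗ₜ[k] V.v i)) := by
  have hb : (V.χ j (V.g i) : k) * (V.χ i (V.g j) : k) = 1 := by
    rw [mul_comm, ← Units.val_mul, V.braid i j hij, Units.val_one]
  simp only [mul_add, add_mul, Algebra.TensorProduct.tmul_mul_tmul, mul_one, one_mul, grp_mul_v,
    V.grp_comm (V.g i) (V.g j), smul_add, TensorProduct.smul_tmul', TensorProduct.tmul_smul,
    V.v_mul_v i j hij, smul_smul, hb, one_smul]
  abel

theorem comul_nil (i : Fin t) :
    (V.v i ⊗ₜ[k] 1 + V.grp (V.g i) ⊗ₜ[k] V.v i) ^ V.r i =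
      (0 : V.Bosonization ⊗[k] V.Bosonization) := by
  have hr : V.r i ≠ 0 := by have := V.one_lt_r i; omega
  refine add_pow_eq_zero_of_qcomm (q := (V.χ i (V.g i) : k)) (V.one_lt_r i)
    ((V.isPrimitiveRoot i).map_of_injective (f := Units.coeHom k) Units.val_injective) ?_ ?_ ?_
  · simp only [Algebra.TensorProduct.tmul_mul_tmul, mul_one, one_mul, grp_mul_v,
      TensorProduct.smul_tmul']
  · simp [Algebra.TensorProduct.tmul_pow, v_pow]
  · simp [Algebra.TensorProduct.tmul_pow, v_pow]

/-- The comultiplication: `Δ(h) = h ⊗ h` for `h ∈ Γ`, and `v_i` is `(1, g_i)`-primitive,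
`Δ(v_i) = v_i ⊗ 1 + g_i ⊗ v_i`. -/
noncomputable def comulHom : V.Bosonization →ₐ[k] V.Bosonization ⊗[k] V.Bosonization :=
  lift (fun h => V.grp h ⊗ₜ V.grp h)
    (fun i => V.v i ⊗ₜ 1 + V.grp (V.g i) ⊗ₜ V.v i)
    V.comul_one V.comul_mul V.comul_act V.comul_qcomm V.comul_nil

/-- The counit: `ε(h) = 1` for `h ∈ Γ` and `ε(v_i) = 0`. -/
noncomputable def counitHom : V.Bosonization →ₐ[k] k :=
  lift (fun _ => 1) (fun _ => 0) rfl (by simp) (by simp) (by simp)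
    (fun i => zero_pow (by have := V.one_lt_r i; omega))

theorem comulHom_grp (h : Γ) : V.comulHom (V.grp h) = V.grp h ⊗ₜ V.grp h := by
  exact lift_grp _ _ V.comul_one V.comul_mul V.comul_act V.comul_qcomm V.comul_nil h

theorem comulHom_v (i : Fin t) :
    V.comulHom (V.v i) = V.v i ⊗ₜ 1 + V.grp (V.g i) ⊗ₜ V.v i := by
  exact lift_v _ _ V.comul_one V.comul_mul V.comul_act V.comul_qcomm V.comul_nil i

theorem counitHom_grp (h : Γ) : V.counitHom (V.grp h) = 1 := by
  unfold counitHom; rw [lift_grp]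

theorem counitHom_v (i : Fin t) : V.counitHom (V.v i) = 0 := by
  unfold counitHom; rw [lift_v]

noncomputable instance : Bialgebra k V.Bosonization :=
  Bialgebra.ofAlgHom V.comulHom V.counitHom
    (by
      apply algHom_ext
      · intro h; simp [comulHom_grp]
      · intro i
        simp [comulHom_grp, comulHom_v, TensorProduct.add_tmul, TensorProduct.tmul_add, add_assoc,
          Algebra.TensorProduct.one_def])
    (by
      apply algHom_ext
      · intro h; simp [comulHom_grp, counitHom_grp]
      · intro i; simp [comulHom_v, counitHom_grp, counitHom_v])
    (by
      apply algHom_ext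
      · intro h; simp [comulHom_grp, counitHom_grp]
      · intro i; simp [comulHom_v, counitHom_v])

/-- The degree `n` component of `B(V) # k[Γ]`, spanned by the `h v_{i_1} ⋯ v_{i_n}` with
`h ∈ Γ`. -/
noncomputable def component (n : ℕ) : Submodule k V.Bosonization :=
  Submodule.span k (Set.range V.grp) * Submodule.span k (Set.range V.v) ^ n

end QuantumLinearSpace

/-! ### Liftings -/

section Liftings

variable {k : Type*} [Field k] {Γ : Type*} [CommGroup Γ] {t : ℕ}

/-- An isomorphism of graded Hopf algebras `gr A ≅ B(V) # k[Γ]`, where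
`gr A = A_0 ⊕ A_1 / A_0 ⊕ A_2 / A_1 ⊕ ⋯` is formed with the coradical filtration. It is given by
its components, written as maps `φ_n : A_n → B(V) # k[Γ]` which induce bijections of
`A_n / A_{n-1}` with the degree `n` part of `B(V) # k[Γ]`. A bijection of Hopf algebras is an
isomorphism as soon as it respects multiplication, unit, comultiplication and counit. -/
structure GrIso (V : QuantumLinearSpace k Γ t) (A : Type*) [Ring A] [HopfAlgebra k A] where
  φ : (n : ℕ) → coradicalFiltration k A n →ₗ[k] V.Bosonization
  range_φ : ∀ n, LinearMap.range (φ n) = V.component n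
  ker_φ_zero : LinearMap.ker (φ 0) = ⊥
  ker_φ_succ : ∀ n, LinearMap.ker (φ (n + 1)) =
    (coradicalFiltration k A n).comap (coradicalFiltration k A (n + 1)).subtype
  map_one : ∃ h : (1 : A) ∈ coradicalFiltration k A 0, φ 0 ⟨1, h⟩ = 1
  /-- The product of the classes of `a ∈ A_m` and `b ∈ A_n` in `gr A` is the class of
  `a b ∈ A_{m+n}`. -/
  map_mul : ∀ (m n : ℕ) (a : coradicalFiltration k A m) (b : coradicalFiltration k A n),
    ∃ h : (a * b : A) ∈ coradicalFiltration k A (m + n), φ (m + n) ⟨a * b, h⟩ = φ m a * φ n b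
  /-- The comultiplication of `gr A`: for `a ∈ A_n` one has `Δ(a) = ∑_{i+j=n} T_{i,j}` with
  `T_{i,j} ∈ A_i ⊗ A_j`, and the coproduct of the class of `a` is the sum of the classes of the
  `T_{i,j}` in `A_i / A_{i-1} ⊗ A_j / A_{j-1}`. -/
  map_comul : ∀ (n : ℕ) (a : coradicalFiltration k A n),
    ∃ T : (p : ℕ × ℕ) → coradicalFiltration k A p.1 ⊗[k] coradicalFiltration k A p.2,
      Coalgebra.comul (R := k) (a : A) = ∑ p ∈ Finset.HasAntidiagonal.antidiagonal n,
        TensorProduct.map (coradicalFiltration k A p.1).subtype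
          (coradicalFiltration k A p.2).subtype (T p) ∧
      Coalgebra.comul (R := k) (φ n a) = ∑ p ∈ Finset.HasAntidiagonal.antidiagonal n,
        TensorProduct.map (φ p.1) (φ p.2) (T p)
  /-- The counit of `gr A` is the counit of `A` in degree `0` (and zero in positive degrees). -/
  map_counit : ∀ a : coradicalFiltration k A 0,
    Coalgebra.counit (R := k) (φ 0 a) = Coalgebra.counit (R := k) (a : A)

/-- A Hopf algebra `A` which is a lifting of `B(V) # k[Γ]`, i.e. `gr A ≅ B(V) # k[Γ]`, together
with the induced identification of `Γ` with the group of grouplikes of `A`, and with liftings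
`x_i ∈ A_1` of the elements `v_i`: `x_i` is `(1, g_i)`-primitive,
`h x_i = χ_i(h) x_i h` for `h ∈ Γ`, and the class of `x_i` in `A_1 / A_0` is `v_i`. -/
structure Lifting (V : QuantumLinearSpace k Γ t) (A : Type*) [Ring A] [HopfAlgebra k A]
    extends GrIso V A where
  grp : Γ →* A
  isGroupLikeElem_grp : ∀ h, IsGroupLikeElem k (grp h)
  grp_class : ∀ h, ∃ hh : grp h ∈ coradicalFiltration k A 0, φ 0 ⟨grp h, hh⟩ = V.grp h
  x : Fin t → A
  comul_x : ∀ i, Coalgebra.comul (R := k) (x i) = x i ⊗ₜ[k] 1 + grp (V.g i) ⊗ₜ[k] x i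
  grp_mul_x : ∀ h i, grp h * x i = (V.χ i h : k) • (x i * grp h)
  x_class : ∀ i, ∃ hx : x i ∈ coradicalFiltration k A 1, φ 1 ⟨x i, hx⟩ = V.v i

/-- The lifting `A`, with the given `x_i`, has lifting matrix `α`. -/
structure Lifting.HasMatrix {V : QuantumLinearSpace k Γ t} {A : Type*} [Ring A] [HopfAlgebra k A]
    (L : Lifting V A) (α : Matrix (Fin t) (Fin t) k) : Prop where
  x_pow : ∀ i, L.x i ^ V.r i = α i i • (L.grp (V.g i ^ V.r i) - 1)
  x_mul_x : ∀ i j, i ≠ j →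
    L.x i * L.x j = (V.χ j (V.g i) : k) • (L.x j * L.x i) + α i j • (L.grp (V.g i * V.g j) - 1)
  diag : ∀ i, α i i = 0 ∨ α i i = 1
  diag_eq_zero : ∀ i, V.g i ^ V.r i = 1 ∨ V.χ i ^ V.r i ≠ 1 → α i i = 0
  offDiag_eq_zero : ∀ i j, i ≠ j → V.g i * V.g j = 1 ∨ V.χ i * V.χ j ≠ 1 → α i j = 0

/-- The subgroup `Ω` of the character group: all `γ` with `γ(α_{ii} (g_i ^ r_i - 1)) = 0` for all
`i` and `γ(α_{ij} (g_i g_j - 1)) = 0` for all `i ≠ j` (`γ` being extended linearly to `k[Γ]`). -/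
def QuantumLinearSpace.Ω (V : QuantumLinearSpace k Γ t) (α : Matrix (Fin t) (Fin t) k) :
    Subgroup (Γ →* kˣ) where
  carrier := {γ | (∀ i, α i i * ((γ (V.g i ^ V.r i) : k) - 1) = 0) ∧
    ∀ i j, i ≠ j → α i j * ((γ (V.g i * V.g j) : k) - 1) = 0}
  one_mem' := by simp
  mul_mem' := by
    rintro γ δ ⟨h1, h2⟩ ⟨h3, h4⟩
    refine ⟨fun i => ?_, fun i j hij => ?_⟩
    · rw [MonoidHom.mul_apply, Units.val_mul]
      linear_combination (δ (V.g i ^ V.r i) : k) * h1 i + h3 i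
    · rw [MonoidHom.mul_apply, Units.val_mul]
      linear_combination (δ (V.g i * V.g j) : k) * h2 i j hij + h4 i j hij
  inv_mem' := by
    rintro γ ⟨h1, h2⟩
    have key : ∀ (a : k) (u : kˣ), a * ((u : k) - 1) = 0 → a * (((u⁻¹ : kˣ) : k) - 1) = 0 := by
      intro a u h
      have hu : ((u⁻¹ : kˣ) : k) * (u : k) = 1 := u.inv_mul
      linear_combination (-((u⁻¹ : kˣ) : k)) * h + a * hu
    exact ⟨fun i => key _ _ (h1 i), fun i j hij => key _ _ (h2 i j hij)⟩

end Liftings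

/-!
The simple subcoalgebras of the dual `A^*` correspond to the simple `A`-modules: a simple module `S`
given by a surjective matrix representation `ρ` of `A` contributes the span of the matrix
coefficients of `ρ`, a copy of `M^c(dim S, k)` (`isSimpleSubcoalgebra_range_matrixCoeffHom`,
`IsSimpleSubcoalgebra.eq_range_matrixCoeffHom`). So the task is to find the simple `A`-modules.

On a simple module `S` each kernel `ker x_j` is a submodule, because `x_j` commutes with the
generators up to scalars. Hence the nilpotent elements `x_j`, `j ≠ 0`, act as zero. If `s ∈ S` has
weight `γ`, then `x_0 ^ r_0` acts on `s` as the scalar `γ(g_0 ^ r_0) - 1`. If `γ ∈ Ω`, this scalar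
is zero, so that `x_0` acts as zero as well and `S = k s`. Otherwise the vectors `x_0 ^ i s` with
`i < r_0` form a basis of `S`: their weights `γ χ_0 ^ i` are distinct as `χ_0(g_0)` is a primitive
`r_0`-th root of unity (`Lifting.exists_isCyclicRep_of_weight`). The matrices of the generators in
this basis depend on `γ` only, and the weights of `S` form the coset of `γ` modulo `⟨χ_0⟩`. Every
character `γ` occurs: the idempotent `e_γ` of `k[Γ] ⊆ A` is not zero, since grouplike elements are
linearly independent, so it is not in the Jacobson radical and there is a simple module on which it
does not vanish (`Lifting.exists_isMaximal_idem_notMem`).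

The representations that arise are separated by the idempotents of their weights, which gives the
linear independence of all the matrix coefficients (`Lifting.coeffSum_injective`).

The argument uses that `A` is generated by `Γ` and the `x_i` (`Lifting.gen_eq_top`). This
follows from the isomorphism of `gr A` with `B(V) # k[Γ]` by induction along the coradical
filtration, once that filtration is known to exhaust `A` (`exists_coradicalFiltration_eq_top`).
A finite dimensional coalgebra is the dual of its convolution algebra `R`, and there the `n`-th term
of the filtration contains all functionals that vanish on `J ^ (n + 1)`, where `J` is the nilpotent
Jacobson radical of `R`.
-/

/-! ### Dual coalgebras and matrix coefficients -/

section DualOfAlgebra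

variable {k : Type*} [Field k]

theorem IsSubcoalgebra.map {C D : Type*} [AddCommGroup C] [Module k C] [Coalgebra k C]
    [AddCommGroup D] [Module k D] [Coalgebra k D] (f : C →ₗc[k] D) {E : Submodule k C}
    (hE : IsSubcoalgebra k C E) : IsSubcoalgebra k D (E.map f.toLinearMap) := by
  rintro _ ⟨_, ⟨c, hc, rfl⟩, rfl⟩
  obtain ⟨t, ht⟩ := hE ⟨c, hc, rfl⟩
  refine ⟨TensorProduct.map (f.toLinearMap.submoduleMap E) (f.toLinearMap.submoduleMap E) t, ?_⟩
  have h := LinearMap.congr_fun f.map_comp_comul c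
  simp only [LinearMap.comp_apply] at h
  rw [← h, ← ht, ← LinearMap.comp_apply, ← LinearMap.comp_apply, ← TensorProduct.map_comp,
    ← TensorProduct.map_comp]
  rfl

theorem IsSubcoalgebra.top (C : Type*) [AddCommGroup C] [Module k C] [Coalgebra k C] :
    IsSubcoalgebra k C ⊤ := by
  refine le_top.trans (LinearMap.range_eq_top.mpr ?_).ge
  exact TensorProduct.map_surjective (fun c => ⟨⟨c, trivial⟩, rfl⟩) (fun c => ⟨⟨c, trivial⟩, rfl⟩)

theorem IsSubcoalgebra.range {C D : Type*} [AddCommGroup C] [Module k C] [Coalgebra k C]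
    [AddCommGroup D] [Module k D] [Coalgebra k D] (f : C →ₗc[k] D) :
    IsSubcoalgebra k D (LinearMap.range f.toLinearMap) := by
  rw [LinearMap.range_eq_map]
  exact (IsSubcoalgebra.top C).map f

variable {R : Type*} [Ring R] [Algebra k R]

/-- The matrix coefficient `a ↦ ρ(a)_{ij}` of a matrix representation `ρ` of `R`. -/
def matrixCoeff {d : ℕ} (ρ : R →ₐ[k] Matrix (Fin d) (Fin d) k) (i j : Fin d) : Module.Dual k R :=
  Matrix.entryLinearMap k k i j ∘ₗ ρ.toLinearMap

@[simp]
theorem matrixCoeff_apply {d : ℕ} (ρ : R →ₐ[k] Matrix (Fin d) (Fin d) k) (i j : Fin d) (a : R) :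
    matrixCoeff ρ i j a = ρ a i j := rfl

variable [FiniteDimensional k R]

/-- The annihilator in `R` of a subcoalgebra of `R^*` is a two-sided ideal. -/
theorem IsSubcoalgebra.mul_mem_dualCoannihilator {E : Submodule k (Module.Dual k R)}
    (hE : IsSubcoalgebra k (Module.Dual k R) E) {a b : R}
    (h : a ∈ E.dualCoannihilator ∨ b ∈ E.dualCoannihilator) : a * b ∈ E.dualCoannihilator := by
  simp only [Submodule.mem_dualCoannihilator] at h ⊢
  intro f hf
  obtain ⟨t, ht⟩ := hE ⟨f, hf, rfl⟩
  have h1 := LinearMap.congr_fun (dual_dualDistrib_comul k R f) (a ⊗ₜ b)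
  rw [← ht] at h1
  simp only [LinearMap.comp_apply, LinearMap.mul'_apply] at h1
  rw [← h1]
  clear h1 ht
  induction t with
  | zero => simp
  | tmul x y => rcases h with h | h <;> simp [h _ x.2, h _ y.2]
  | add x y hx hy => simp only [map_add, LinearMap.add_apply, hx, hy, add_zero]

/-- The annihilator in `R` of a subcoalgebra of `R^*`, as a two-sided ideal. -/
def IsSubcoalgebra.ideal {E : Submodule k (Module.Dual k R)}
    (hE : IsSubcoalgebra k (Module.Dual k R) E) : TwoSidedIdeal R :=
  .mk' E.dualCoannihilator (zero_mem _) add_mem neg_mem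
    (fun h => hE.mul_mem_dualCoannihilator (.inr h))
    (fun h => hE.mul_mem_dualCoannihilator (.inl h))

theorem IsSubcoalgebra.mem_ideal {E : Submodule k (Module.Dual k R)}
    (hE : IsSubcoalgebra k (Module.Dual k R) E) {a : R} :
    a ∈ hE.ideal ↔ ∀ f ∈ E, f a = 0 := by
  rw [IsSubcoalgebra.ideal, TwoSidedIdeal.mem_mk', SetLike.mem_coe,
    Submodule.mem_dualCoannihilator]

theorem le_of_dualCoannihilator_le {E F : Submodule k (Module.Dual k R)}
    (h : F.dualCoannihilator ≤ E.dualCoannihilator) : E ≤ F := by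
  have := Submodule.dualAnnihilator_anti h
  rwa [Subspace.dualCoannihilator_dualAnnihilator_eq,
    Subspace.dualCoannihilator_dualAnnihilator_eq] at this

section MatrixCoefficients

variable {d : ℕ} (ρ : R →ₐ[k] Matrix (Fin d) (Fin d) k)

theorem comul_matrixCoeff (i j : Fin d) :
    Coalgebra.comul (R := k) (matrixCoeff ρ i j) =
      ∑ s, matrixCoeff ρ i s ⊗ₜ[k] matrixCoeff ρ s j := by
  apply dual_dualDistrib_injective k R R
  rw [dual_dualDistrib_comul]
  refine TensorProduct.ext' fun a b => ?_
  simp [LinearMap.sum_apply, Matrix.mul_apply]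

/-- The coalgebra map `M^c(d, k) → R^*` which sends `e(i, j)` to the matrix coefficient
`a ↦ ρ(a)_{ij}`. -/
noncomputable def matrixCoeffHom : MatrixCoalgebra d k →ₗc[k] Module.Dual k R where
  toLinearMap := (MatrixCoalgebra.basis d k).constr k fun p => matrixCoeff ρ p.1 p.2
  counit_comp := by
    refine (MatrixCoalgebra.basis d k).ext fun p => ?_
    obtain ⟨i, j⟩ := p
    simp only [LinearMap.comp_apply, Module.Basis.constr_basis, MatrixCoalgebra.counit_basis,
      dual_counit_apply, matrixCoeff_apply, map_one, Matrix.one_apply]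
  map_comp_comul := by
    refine (MatrixCoalgebra.basis d k).ext fun p => ?_
    obtain ⟨i, j⟩ := p
    simp only [LinearMap.comp_apply, Module.Basis.constr_basis, MatrixCoalgebra.comul_basis,
      map_sum, TensorProduct.map_tmul, comul_matrixCoeff]

theorem matrixCoeffHom_basis (p : Fin d × Fin d) :
    matrixCoeffHom ρ (MatrixCoalgebra.basis d k p) = matrixCoeff ρ p.1 p.2 :=
  (MatrixCoalgebra.basis d k).constr_basis k _ _

theorem matrixCoeffHom_apply (M : MatrixCoalgebra d k) (a : R) :
    matrixCoeffHom ρ M a = ∑ p : Fin d × Fin d,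
      (MatrixCoalgebra.basis d k).repr M p * ρ a p.1 p.2 := by
  conv_lhs => rw [← (MatrixCoalgebra.basis d k).sum_repr M]
  simp only [map_sum, map_smul, LinearMap.sum_apply, LinearMap.smul_apply, matrixCoeffHom_basis,
    matrixCoeff_apply, smul_eq_mul]

theorem eq_zero_of_sum_repr_mul_eq_zero {M : MatrixCoalgebra d k}
    (h : ∀ N : Matrix (Fin d) (Fin d) k, ∑ p : Fin d × Fin d,
      (MatrixCoalgebra.basis d k).repr M p * N p.1 p.2 = 0) : M = 0 := by
  apply (MatrixCoalgebra.basis d k).ext_elem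
  rintro ⟨i, j⟩
  have := h (Matrix.single i j 1)
  rw [Finset.sum_eq_single (i, j)] at this
  · simpa using this
  · rintro ⟨i', j'⟩ - hne
    rw [Matrix.single_apply_of_ne, mul_zero]
    rintro ⟨rfl, rfl⟩
    exact hne rfl
  · simp

variable {ρ}

theorem matrixCoeffHom_injective (hρ : Function.Surjective ρ) :
    Function.Injective (matrixCoeffHom ρ) := by
  refine (injective_iff_map_eq_zero (matrixCoeffHom ρ)).mpr fun M hM => ?_
  refine eq_zero_of_sum_repr_mul_eq_zero fun N => ?_
  obtain ⟨a, rfl⟩ := hρ N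
  rw [← matrixCoeffHom_apply, hM, LinearMap.zero_apply]

/-- The matrix coefficients of a surjective representation span the functionals that vanish on
its kernel. -/
theorem mem_range_matrixCoeffHom (hρ : Function.Surjective ρ) {f : Module.Dual k R} :
    f ∈ LinearMap.range (matrixCoeffHom ρ).toLinearMap ↔ ∀ a, ρ a = 0 → f a = 0 := by
  constructor
  · rintro ⟨M, rfl⟩ a ha
    change matrixCoeffHom ρ M a = 0
    simp [matrixCoeffHom_apply, ha]
  · intro h
    obtain ⟨g, hg⟩ := LinearMap.exists_rightInverse_of_surjective ρ.toLinearMap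
      (LinearMap.range_eq_top.mpr hρ)
    have hg' : ∀ N, ρ (g N) = N := fun N => LinearMap.congr_fun hg N
    refine ⟨∑ p : Fin d × Fin d, f (g (Matrix.single p.1 p.2 1)) •
      MatrixCoalgebra.basis d k (p.1, p.2), ?_⟩
    ext a
    change matrixCoeffHom ρ _ a = f a
    have h1 : f a = f (g (ρ a)) := by
      rw [← sub_eq_zero, ← map_sub]
      exact h _ (by rw [map_sub, hg', sub_self])
    rw [h1]
    conv_rhs => rw [Matrix.matrix_eq_sum_single (ρ a)]
    have h2 : ∀ i j, Matrix.single i j (ρ a i j) = ρ a i j • Matrix.single i j (1 : k) := by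
      intro i j; simp
    simp only [h2, map_sum, map_smul, LinearMap.sum_apply, LinearMap.smul_apply,
      matrixCoeffHom_basis, matrixCoeff_apply, smul_eq_mul, Fintype.sum_prod_type]
    exact Finset.sum_congr rfl fun i _ => Finset.sum_congr rfl fun j _ => mul_comm _ _

/-- The matrix coefficients of a surjective representation span a simple subcoalgebra: an ideal
of `R` that contains the kernel of the representation is the kernel or everything, as matrix
rings are simple. -/
theorem isSimpleSubcoalgebra_range_matrixCoeffHom (hd : d ≠ 0) (hρ : Function.Surjective ρ) :
    IsSimpleSubcoalgebra k (Module.Dual k R) (LinearMap.range (matrixCoeffHom ρ).toLinearMap) := by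
  have : NeZero d := ⟨hd⟩
  refine ⟨IsSubcoalgebra.range _, ?_, fun E hE hle => ?_⟩
  · intro h
    have h0 := LinearMap.range_eq_bot.mp h
    have h1 : matrixCoeffHom ρ (MatrixCoalgebra.basis d k (0, 0)) = 0 :=
      LinearMap.congr_fun h0 _
    exact (MatrixCoalgebra.basis d k).ne_zero (0, 0)
      (matrixCoeffHom_injective hρ (h1.trans (map_zero _).symm))
  have hker : ∀ a, ρ a = 0 → a ∈ hE.ideal := fun a ha =>
    hE.mem_ideal.mpr fun f hf => (mem_range_matrixCoeffHom hρ).mp (hle hf) a ha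
  let I : TwoSidedIdeal (Matrix (Fin d) (Fin d) k) := .mk' {M | ∃ a ∈ hE.ideal, ρ a = M}
    ⟨0, zero_mem _, map_zero _⟩
    (by rintro _ _ ⟨a, ha, rfl⟩ ⟨b, hb, rfl⟩; exact ⟨a + b, add_mem ha hb, map_add _ _ _⟩)
    (by rintro _ ⟨a, ha, rfl⟩; exact ⟨-a, neg_mem ha, map_neg _ _⟩)
    (by
      rintro M _ ⟨a, ha, rfl⟩
      obtain ⟨b, rfl⟩ := hρ M
      exact ⟨b * a, TwoSidedIdeal.mul_mem_left _ _ _ ha, map_mul _ _ _⟩)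
    (by
      rintro _ M ⟨a, ha, rfl⟩
      obtain ⟨b, rfl⟩ := hρ M
      exact ⟨a * b, TwoSidedIdeal.mul_mem_right _ _ _ ha, map_mul _ _ _⟩)
  have hI : ∀ M, M ∈ I ↔ ∃ a ∈ hE.ideal, ρ a = M := fun M => by
    simp only [I, TwoSidedIdeal.mem_mk', Set.mem_ofPred_eq]
  rcases eq_bot_or_eq_top I with h | h
  · right
    refine le_antisymm hle (le_of_dualCoannihilator_le fun a ha => ?_)
    rw [Submodule.mem_dualCoannihilator] at ha ⊢
    have h0 : ρ a = 0 := by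
      have : ρ a ∈ I := (hI _).mpr ⟨a, hE.mem_ideal.mpr ha, rfl⟩
      rwa [h, TwoSidedIdeal.mem_bot] at this
    exact fun f hf => (mem_range_matrixCoeffHom hρ).mp hf a h0
  · left
    have h1 : (1 : Matrix (Fin d) (Fin d) k) ∈ I := h ▸ trivial
    obtain ⟨a, ha, ha1⟩ := (hI _).mp h1
    have h2 : (1 : R) ∈ hE.ideal := by
      have := add_mem ha (hker (1 - a) (by simp [ha1]))
      simpa using this
    rw [eq_bot_iff]
    intro f hf
    rw [Submodule.mem_bot]
    ext b
    have := hE.mem_ideal.mp (TwoSidedIdeal.mul_mem_right _ _ b h2) f hf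
    simpa using this

end MatrixCoefficients

end DualOfAlgebra

/-! ### Exhaustiveness of the coradical filtration -/

section Exhaustion

variable {k : Type*} [Field k]

theorem eq_zero_of_forall_dualDistrib {M N : Type*} [AddCommGroup M] [Module k M]
    [AddCommGroup N] [Module k N] [FiniteDimensional k M] [FiniteDimensional k N] {z : M ⊗[k] N}
    (h : ∀ φ ψ, TensorProduct.dualDistrib k M N (φ ⊗ₜ ψ) z = 0) : z = 0 := by
  refine (Module.forall_dual_apply_eq_zero_iff k z).mp fun θ => ?_
  obtain ⟨T, rfl⟩ := (TensorProduct.dualDistribEquiv k M N).surjective θ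
  change TensorProduct.dualDistrib k M N T z = 0
  induction T with
  | zero => simp
  | tmul φ ψ => exact h φ ψ
  | add x y hx hy => rw [map_add, LinearMap.add_apply, hx, hy, add_zero]

theorem mem_range_sup_range_of_forall_dualDistrib {M N : Type*} [AddCommGroup M] [Module k M]
    [AddCommGroup N] [Module k N] [FiniteDimensional k M] [FiniteDimensional k N]
    (Y : Submodule k M) (X : Submodule k N) {z : M ⊗[k] N}
    (h : ∀ φ ∈ Y.dualAnnihilator, ∀ ψ ∈ X.dualAnnihilator,
      TensorProduct.dualDistrib k M N (φ ⊗ₜ ψ) z = 0) :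
    z ∈ LinearMap.range (TensorProduct.map (LinearMap.id : M →ₗ[k] M) X.subtype) ⊔
      LinearMap.range (TensorProduct.map Y.subtype (LinearMap.id : N →ₗ[k] N)) := by
  have hker := TensorProduct.map_ker (LinearMap.exact_subtype_mkQ Y) Y.mkQ_surjective
    (LinearMap.exact_subtype_mkQ X) X.mkQ_surjective
  change z ∈ LinearMap.range (LinearMap.lTensor M X.subtype) ⊔
    LinearMap.range (LinearMap.rTensor N Y.subtype)
  rw [← hker, LinearMap.mem_ker]
  refine eq_zero_of_forall_dualDistrib fun φ ψ => ?_
  have key : TensorProduct.dualDistrib k _ _ (φ ⊗ₜ ψ) (TensorProduct.map Y.mkQ X.mkQ z) =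
      TensorProduct.dualDistrib k M N ((φ ∘ₗ Y.mkQ) ⊗ₜ (ψ ∘ₗ X.mkQ)) z := by
    clear h
    induction z with
    | zero => simp
    | tmul x y => simp
    | add x y hx hy => simp only [map_add, hx, hy]
  rw [key]
  refine h _ ?_ _ ?_
  · rw [Submodule.mem_dualAnnihilator]
    intro g hg
    rw [LinearMap.comp_apply, Submodule.mkQ_apply, (Submodule.Quotient.mk_eq_zero Y).mpr hg,
      map_zero]
  · rw [Submodule.mem_dualAnnihilator]
    intro g hg
    rw [LinearMap.comp_apply, Submodule.mkQ_apply, (Submodule.Quotient.mk_eq_zero X).mpr hg,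
      map_zero]

variable {R : Type*} [Ring R] [Algebra k R] [FiniteDimensional k R]

/-- Membership in the wedge `Δ⁻¹(R^* ⊗ X + Y ⊗ R^*)`, in terms of the product of `R`. -/
theorem comul_mem_sup_of_forall_mul {X Y : Submodule k (Module.Dual k R)} {f : Module.Dual k R}
    (h : ∀ a ∈ Y.dualCoannihilator, ∀ b ∈ X.dualCoannihilator, f (a * b) = 0) :
    Coalgebra.comul (R := k) f ∈
      LinearMap.range (TensorProduct.map (LinearMap.id : Module.Dual k R →ₗ[k] _) X.subtype) ⊔
      LinearMap.range
        (TensorProduct.map Y.subtype (LinearMap.id : Module.Dual k R →ₗ[k] _)) := by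
  refine mem_range_sup_range_of_forall_dualDistrib Y X fun φ hφ ψ hψ => ?_
  obtain ⟨a, rfl⟩ := (Module.evalEquiv k R).surjective φ
  obtain ⟨b, rfl⟩ := (Module.evalEquiv k R).surjective ψ
  have key : ∀ T : Module.Dual k R ⊗[k] Module.Dual k R,
      TensorProduct.dualDistrib k _ _ (Module.evalEquiv k R a ⊗ₜ Module.evalEquiv k R b) T =
        TensorProduct.dualDistrib k R R T (a ⊗ₜ b) := by
    intro T
    induction T with
    | zero => simp
    | tmul x y => simp
    | add x y hx hy => simp only [map_add, LinearMap.add_apply, hx, hy]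
  rw [key, dual_dualDistrib_comul]
  refine h a ?_ b ?_ <;> rw [Submodule.mem_dualCoannihilator] <;> intro g hg
  · exact (Submodule.mem_dualAnnihilator _).mp hφ g hg
  · exact (Submodule.mem_dualAnnihilator _).mp hψ g hg

variable [IsAlgClosed k]

/-- The orthogonal complement of the coradical of `R^*` lies in the Jacobson radical `J`: the
quotient `R / J` is a product of matrix algebras, each of which contributes a simple subcoalgebra
to the coradical. -/
theorem mem_jacobson_of_mem_dualCoannihilator_coradical {a : R}
    (ha : a ∈ (coradical k (Module.Dual k R)).dualCoannihilator) : a ∈ Ring.jacobson R := by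
  have : IsArtinianRing R := .of_finite k R
  obtain ⟨n, d, hd, ⟨e⟩⟩ :=
    IsSemisimpleRing.exists_algEquiv_pi_matrix_of_isAlgClosed k (R ⧸ Ring.jacobson R)
  rw [← Ideal.Quotient.eq_zero_iff_mem, ← map_eq_zero_iff e e.injective]
  funext i
  let ρ : R →ₐ[k] Matrix (Fin (d i)) (Fin (d i)) k :=
    ((Pi.evalAlgHom k _ i).comp e.toAlgHom).comp (Ideal.Quotient.mkₐ k (Ring.jacobson R))
  have hρ : Function.Surjective ρ :=
    ((Function.surjective_eval i).comp e.surjective).comp Ideal.Quotient.mk_surjective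
  rw [Submodule.mem_dualCoannihilator] at ha
  have hle : LinearMap.range (matrixCoeffHom ρ).toLinearMap ≤ coradical k (Module.Dual k R) :=
    le_sSup (isSimpleSubcoalgebra_range_matrixCoeffHom (hd i).out hρ)
  ext p q
  have := ha _ (hle ⟨MatrixCoalgebra.basis (d i) k (p, q), rfl⟩)
  change matrixCoeffHom ρ _ a = 0 at this
  rwa [matrixCoeffHom_basis] at this

/-- The wedge `Δ⁻¹(R^* ⊗ C_n + C_0 ⊗ R^*)` consists of the functionals that vanish on the product
of the orthogonal complements of `C_0` and `C_n`, which by induction lies in `J * J ^ (n + 1)`. -/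
theorem mem_coradicalFiltration_dual (n : ℕ) (f : Module.Dual k R)
    (hf : ∀ a ∈ Ring.jacobson R ^ (n + 1), f a = 0) :
    f ∈ coradicalFiltration k (Module.Dual k R) n := by
  induction n generalizing f with
  | zero =>
    rw [zero_add, Submodule.pow_one] at hf
    change f ∈ coradical k (Module.Dual k R)
    rw [← Subspace.dualCoannihilator_dualAnnihilator_eq (W := coradical k (Module.Dual k R)),
      Submodule.mem_dualAnnihilator]
    exact fun a ha => hf a (mem_jacobson_of_mem_dualCoannihilator_coradical ha)
  | succ n ih =>
    refine comul_mem_sup_of_forall_mul fun a ha b hb => hf _ ?_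
    rw [Submodule.pow_succ' _ n.succ_ne_zero]
    refine Submodule.mul_mem_mul (mem_jacobson_of_mem_dualCoannihilator_coradical ha) ?_
    -- Otherwise a functional on `R / J ^ (n + 1)` separates `b` from zero; it lies in `C_n`.
    by_contra hb'
    let W : Submodule k R := (Ring.jacobson R ^ (n + 1)).restrictScalars k
    obtain ⟨g, hg, hgW⟩ := Submodule.exists_le_ker_of_notMem (p := W) (v := b) hb'
    rw [Submodule.mem_dualCoannihilator] at hb
    exact hg (hb g (ih g fun a ha => hgW ha))

theorem exists_coradicalFiltration_dual_eq_top :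
    ∃ n, coradicalFiltration k (Module.Dual k R) n = ⊤ := by
  have : IsArtinianRing R := .of_finite k R
  obtain ⟨n, hn⟩ := IsArtinianRing.isNilpotent_jacobson_bot (R := R)
  rw [Ideal.jacobson_bot] at hn
  refine ⟨n, eq_top_iff.mpr fun f _ => mem_coradicalFiltration_dual n f fun a ha => ?_⟩
  rw [Submodule.pow_succ, hn, zero_mul] at ha
  rw [(Submodule.mem_bot R).mp ha, map_zero]

end Exhaustion

section Transport

variable {k : Type*} [Field k] {C D : Type*} [AddCommGroup C] [Module k C] [Coalgebra k C]
  [AddCommGroup D] [Module k D] [Coalgebra k D]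

theorem IsSimpleSubcoalgebra.map_equiv (e : C ≃ₗc[k] D) {E : Submodule k C}
    (hE : IsSimpleSubcoalgebra k C E) :
    IsSimpleSubcoalgebra k D (E.map e.toLinearEquiv.toLinearMap) := by
  obtain ⟨h1, h2, h3⟩ := hE
  refine ⟨h1.map (e : C →ₗc[k] D), fun h => h2 ?_, fun F hF hle => ?_⟩
  · exact (Submodule.map_eq_bot_iff (p := E) (e := e.toLinearEquiv)).mp h
  have hF' : IsSubcoalgebra k C (F.map e.toLinearEquiv.symm.toLinearMap) :=
    hF.map (e.symm : D →ₗc[k] C)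
  have hF'' : (F.map e.toLinearEquiv.symm.toLinearMap).map e.toLinearEquiv.toLinearMap = F :=
    (Submodule.map_symm_eq_iff e.toLinearEquiv).mp rfl
  have hle' : F.map e.toLinearEquiv.symm.toLinearMap ≤ E := by
    rintro _ ⟨x, hx, rfl⟩
    obtain ⟨y, hy, rfl⟩ := hle hx
    simpa using hy
  rcases h3 _ hF' hle' with h | h
  · left
    rw [← hF'', h, Submodule.map_bot]
  · right
    rw [← hF'', h]

theorem map_coradical_le (e : C ≃ₗc[k] D) :
    (coradical k C).map e.toLinearEquiv.toLinearMap ≤ coradical k D := by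
  rw [Submodule.map_le_iff_le_comap]
  exact sSup_le fun E hE => Submodule.map_le_iff_le_comap.mp (le_sSup (hE.map_equiv e))

theorem map_coradicalFiltration_le (e : C ≃ₗc[k] D) (n : ℕ) :
    (coradicalFiltration k C n).map e.toLinearEquiv.toLinearMap ≤ coradicalFiltration k D n := by
  induction n with
  | zero => exact map_coradical_le e
  | succ n ih =>
    rintro _ ⟨c, hc, rfl⟩
    have h : TensorProduct.map e.toLinearEquiv.toLinearMap e.toLinearEquiv.toLinearMap
        (Coalgebra.comul c) = Coalgebra.comul (R := k) (e.toLinearEquiv.toLinearMap c) :=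
      LinearMap.congr_fun (e : C →ₗc[k] D).map_comp_comul c
    obtain ⟨_, ⟨s, rfl⟩, _, ⟨t, rfl⟩, hst⟩ := Submodule.mem_sup.mp hc
    refine Submodule.mem_comap.mpr ?_
    rw [← h, ← hst, map_add]
    refine Submodule.add_mem_sup ?_ ?_
    · refine ⟨TensorProduct.map e.toLinearEquiv.toLinearMap
        (e.toLinearEquiv.toLinearMap.restrict fun x hx => ih ⟨x, hx, rfl⟩) s, ?_⟩
      rw [← LinearMap.comp_apply, ← LinearMap.comp_apply, ← TensorProduct.map_comp,
        ← TensorProduct.map_comp]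
      rfl
    · refine ⟨TensorProduct.map (e.toLinearEquiv.toLinearMap.restrict
        fun x hx => map_coradical_le e ⟨x, hx, rfl⟩) e.toLinearEquiv.toLinearMap t, ?_⟩
      rw [← LinearMap.comp_apply, ← LinearMap.comp_apply, ← TensorProduct.map_comp,
        ← TensorProduct.map_comp]
      rfl

instance [FiniteDimensional k C] : FiniteDimensional k (WithConv (C →ₗ[k] k)) :=
  .of_surjective (WithConv.linearEquiv k (C →ₗ[k] k)).symm.toLinearMap (LinearEquiv.surjective _)

/-- A linear isomorphism of `C` with the dual of an algebra `R` is an isomorphism of coalgebras if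
the comultiplication of `C` is dual to the multiplication of `R`. -/
noncomputable def CoalgEquiv.ofDual {R : Type*} [Ring R] [Algebra k R] [FiniteDimensional k R]
    (e : C ≃ₗ[k] Module.Dual k R) (h1 : ∀ c, e c 1 = Coalgebra.counit c)
    (h2 : ∀ c a b, e c (a * b) = TensorProduct.dualDistrib k R R
      (TensorProduct.map e.toLinearMap e.toLinearMap (Coalgebra.comul c)) (a ⊗ₜ b)) :
    C ≃ₗc[k] Module.Dual k R where
  __ := e
  counit_comp := LinearMap.ext h1
  map_comp_comul := by
    refine LinearMap.ext fun c => dual_dualDistrib_injective k R R ?_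
    refine TensorProduct.ext' fun a b => ?_
    exact (h2 c a b).symm.trans
      (LinearMap.congr_fun (dual_dualDistrib_comul k R (e c)) (a ⊗ₜ b)).symm

/-- A finite dimensional coalgebra is the dual of its convolution algebra. -/
noncomputable def Coalgebra.equivDualConv (k C : Type*) [Field k] [AddCommGroup C] [Module k C]
    [Coalgebra k C] [FiniteDimensional k C] : C ≃ₗc[k] Module.Dual k (WithConv (C →ₗ[k] k)) :=
  CoalgEquiv.ofDual
    ((Module.evalEquiv k C).trans (WithConv.linearEquiv k (C →ₗ[k] k)).dualMap)
    (fun c => LinearMap.convOne_apply (R := k) (A := k) c) (fun c f g => by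
      change (f * g) c = _
      rw [LinearMap.convMul_apply]
      generalize Coalgebra.comul (R := k) c = T
      induction T with
      | zero => simp
      | tmul x y => rfl
      | add x y hx hy => simp only [map_add, LinearMap.add_apply, hx, hy])

/-- The coradical filtration of a finite dimensional coalgebra is exhaustive. -/
theorem exists_coradicalFiltration_eq_top (k C : Type*) [Field k] [IsAlgClosed k]
    [AddCommGroup C] [Module k C] [Coalgebra k C] [FiniteDimensional k C] :
    ∃ n, coradicalFiltration k C n = ⊤ := by
  obtain ⟨n, hn⟩ := exists_coradicalFiltration_dual_eq_top (k := k) (R := WithConv (C →ₗ[k] k))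
  refine ⟨n, eq_top_iff.mpr fun c _ => ?_⟩
  let e := Coalgebra.equivDualConv k C
  have hc : e c ∈ coradicalFiltration k (Module.Dual k (WithConv (C →ₗ[k] k))) n := by
    rw [hn]; trivial
  have := map_coradicalFiltration_le (C := Module.Dual k (WithConv (C →ₗ[k] k))) (D := C) e.symm n
    ⟨e c, hc, rfl⟩
  change e.symm (e c) ∈ _ at this
  simpa using this

end Transport

/-! ### Generation of a lifting -/

namespace Lifting

variable {k : Type*} [Field k] {Γ : Type*} [CommGroup Γ] {t : ℕ} {V : QuantumLinearSpace k Γ t}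
  {A : Type*} [Ring A] [HopfAlgebra k A] (L : Lifting V A)

/-- The subalgebra of `A` generated by `Γ` and the `x_i`. -/
def gen : Subalgebra k A := Algebra.adjoin k (Set.range L.grp ∪ Set.range L.x)

theorem grp_mem_gen (h : Γ) : L.grp h ∈ L.gen := Algebra.subset_adjoin (.inl ⟨h, rfl⟩)

theorem x_mem_gen (i : Fin t) : L.x i ∈ L.gen := Algebra.subset_adjoin (.inr ⟨i, rfl⟩)

/-- The image of the generated subalgebra in degree `n` of `gr A`, viewed in `B(V) # k[Γ]` through
the isomorphism that is part of `L`. -/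
noncomputable def grGen (n : ℕ) : Submodule k V.Bosonization :=
  (L.gen.toSubmodule.comap (coradicalFiltration k A n).subtype).map (L.φ n)

theorem grGen_mul_le (m n : ℕ) : L.grGen m * L.grGen n ≤ L.grGen (m + n) := by
  rw [Submodule.mul_le]
  rintro _ ⟨a, ha, rfl⟩ _ ⟨b, hb, rfl⟩
  obtain ⟨h, hab⟩ := L.map_mul m n a b
  exact ⟨⟨a * b, h⟩, L.gen.mul_mem ha hb, hab⟩

theorem span_v_pow_le (n : ℕ) : Submodule.span k (Set.range V.v) ^ n ≤ L.grGen n := by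
  induction n with
  | zero =>
    rw [pow_zero, Submodule.one_le]
    obtain ⟨h, h1⟩ := L.map_one
    exact ⟨⟨1, h⟩, one_mem L.gen, h1⟩
  | succ n ih =>
    have h1 : Submodule.span k (Set.range V.v) ≤ L.grGen 1 := by
      rw [Submodule.span_le]
      rintro _ ⟨i, rfl⟩
      obtain ⟨h, hi⟩ := L.x_class i
      exact ⟨⟨L.x i, h⟩, L.x_mem_gen i, hi⟩
    rw [pow_succ]
    exact (mul_le_mul' ih h1).trans (L.grGen_mul_le n 1)

theorem component_le_grGen (n : ℕ) : V.component n ≤ L.grGen n := by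
  have h0 : Submodule.span k (Set.range V.grp) ≤ L.grGen 0 := by
    rw [Submodule.span_le]
    rintro _ ⟨g, rfl⟩
    obtain ⟨h, hg⟩ := L.grp_class g
    exact ⟨⟨L.grp g, h⟩, L.grp_mem_gen g, hg⟩
  have h := (mul_le_mul' h0 (L.span_v_pow_le n)).trans (L.grGen_mul_le 0 n)
  rwa [Nat.zero_add] at h

/-- An element of the `n`-th term of the filtration agrees with an element of the generated
subalgebra up to the kernel of the map to degree `n` of `gr A`, which is the previous term. -/
theorem coradicalFiltration_le_gen (n : ℕ) :
    coradicalFiltration k A n ≤ L.gen.toSubmodule := by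
  have key : ∀ n (a : coradicalFiltration k A n),
      ∃ b : coradicalFiltration k A n, (b : A) ∈ L.gen ∧ a - b ∈ LinearMap.ker (L.φ n) := by
    intro n a
    have ha : L.φ n a ∈ V.component n := L.range_φ n ▸ ⟨a, rfl⟩
    obtain ⟨b, hb, hab⟩ := L.component_le_grGen n ha
    exact ⟨b, hb, by rw [LinearMap.mem_ker, map_sub, hab, sub_self]⟩
  induction n with
  | zero =>
    intro a ha
    obtain ⟨b, hb, hab⟩ := key 0 ⟨a, ha⟩
    rw [L.ker_φ_zero, Submodule.mem_bot, sub_eq_zero] at hab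
    rwa [← hab] at hb
  | succ n ih =>
    intro a ha
    obtain ⟨b, hb, hab⟩ := key (n + 1) ⟨a, ha⟩
    rw [L.ker_φ_succ] at hab
    have := add_mem (ih hab) hb
    simpa using this

/-- A lifting is generated by `Γ` and the `x_i`. -/
theorem gen_eq_top [IsAlgClosed k] [FiniteDimensional k A] : L.gen = ⊤ := by
  obtain ⟨n, hn⟩ := exists_coradicalFiltration_eq_top k A
  exact eq_top_iff.mpr fun a _ => L.coradicalFiltration_le_gen n (hn ▸ Submodule.mem_top)

theorem algHom_ext [IsAlgClosed k] [FiniteDimensional k A] {B : Type*} [Ring B] [Algebra k B]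
    {φ ψ : A →ₐ[k] B} (hg : ∀ h, φ (L.grp h) = ψ (L.grp h)) (hx : ∀ i, φ (L.x i) = ψ (L.x i)) :
    φ = ψ := by
  refine AlgHom.ext_of_adjoin_eq_top L.gen_eq_top ?_
  rintro _ (⟨h, rfl⟩ | ⟨i, rfl⟩)
  · exact hg h
  · exact hx i

/-- A `k`-subspace of an `A`-module that is stable under `Γ` and the `x_i` is a submodule. -/
def submoduleOfStable [IsAlgClosed k] [FiniteDimensional k A] {S : Type*} [AddCommGroup S]
    [Module k S] [Module A S] [IsScalarTower k A S] (W : Submodule k S)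
    (hg : ∀ h, ∀ s ∈ W, L.grp h • s ∈ W) (hx : ∀ i, ∀ s ∈ W, L.x i • s ∈ W) :
    Submodule A S where
  __ := W
  smul_mem' := by
    intro a s hs
    have ha : a ∈ L.gen := L.gen_eq_top ▸ Algebra.mem_top
    change a • s ∈ W
    induction ha using Algebra.adjoin_induction generalizing s with
    | mem a ha =>
      rcases ha with ⟨h, rfl⟩ | ⟨i, rfl⟩
      · exact hg h s hs
      · exact hx i s hs
    | algebraMap c => rw [algebraMap_smul]; exact W.smul_mem c hs
    | add a b _ _ iha ihb => rw [add_smul]; exact W.add_mem (iha hs) (ihb hs)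
    | mul a b _ _ iha ihb => rw [mul_smul]; exact iha (ihb hs)

/-- A nonzero stable subspace of a simple module is everything. -/
theorem eq_top_of_stable [IsAlgClosed k] [FiniteDimensional k A] {S : Type*} [AddCommGroup S]
    [Module k S] [Module A S] [IsScalarTower k A S] [IsSimpleModule A S] {W : Submodule k S}
    (hW : W ≠ ⊥)
    (hg : ∀ h, ∀ s ∈ W, L.grp h • s ∈ W) (hx : ∀ i, ∀ s ∈ W, L.x i • s ∈ W) : W = ⊤ := by
  obtain ⟨w, hw, hw0⟩ := Submodule.exists_mem_ne_zero_of_ne_bot hW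
  rcases eq_bot_or_eq_top (L.submoduleOfStable W hg hx) with h | h
  · exact absurd ((Submodule.mem_bot A).mp (h ▸ (show w ∈ L.submoduleOfStable W hg hx from hw))) hw0
  · exact eq_top_iff.mpr fun s _ =>
      show s ∈ L.submoduleOfStable W hg hx from h ▸ Submodule.mem_top

end Lifting

namespace QuantumLinearSpace

variable {k : Type*} [Field k] {Γ : Type*} [CommGroup Γ] {t : ℕ} (V : QuantumLinearSpace k Γ t)

theorem grp_injective : Function.Injective V.grp := by
  let f : V.Bosonization →ₐ[k] MonoidAlgebra k Γ :=
    lift (fun h => MonoidAlgebra.of k Γ h) (fun _ => 0) (map_one _) (map_mul _) (by simp) (by simp)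
      (fun i => zero_pow (by have := V.one_lt_r i; omega))
  have hf : ∀ h, f (V.grp h) = MonoidAlgebra.of k Γ h := fun h => lift_grp _ _ _ _ _ _ _ h
  intro g h hgh
  refine MonoidAlgebra.of_injective (R := k) ?_
  rw [← hf, ← hf, hgh]

end QuantumLinearSpace

namespace Lifting

variable {k : Type*} [Field k] {Γ : Type*} [CommGroup Γ] {t : ℕ} {V : QuantumLinearSpace k Γ t}
  {A : Type*} [Ring A] [HopfAlgebra k A] (L : Lifting V A)

theorem grp_injective : Function.Injective L.grp := by
  intro g h hgh
  obtain ⟨h1, h2⟩ := L.grp_class g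
  obtain ⟨h3, h4⟩ := L.grp_class h
  apply V.grp_injective
  rw [← h2, ← h4]
  congr 2

theorem linearIndependent_grp : LinearIndependent k L.grp := by
  have h := (linearIndepOn_isGroupLikeElem (R := k) (A := A)).mono
    (Set.range_subset_iff.mpr L.isGroupLikeElem_grp)
  exact (linearIndepOn_id_range_iff L.grp_injective).mp h

end Lifting

/-! ### Characters and weight idempotents -/

section Characters

variable {k : Type*} [Field k] {Γ : Type*} [CommGroup Γ] [Fintype Γ]

theorem sum_character_inv_mul (γ δ : Γ →* kˣ) [Decidable (γ = δ)] :
    ∑ h, ((γ h)⁻¹ : kˣ) * (δ h : k) = if γ = δ then (Fintype.card Γ : k) else 0 := by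
  split_ifs with h
  · subst h
    simp
  · obtain ⟨g, hg⟩ : ∃ g, (γ g)⁻¹ * δ g ≠ 1 := by
      by_contra! hne
      exact h (MonoidHom.ext fun g => inv_mul_eq_one.mp (hne g))
    have hg' : (((γ g)⁻¹ * δ g : kˣ) : k) ≠ 1 := fun h => hg (Units.ext h)
    refine (mul_eq_zero.mp ?_).resolve_left (sub_ne_zero.mpr hg')
    rw [sub_mul, one_mul, Finset.mul_sum, sub_eq_zero]
    refine (Fintype.sum_equiv (Equiv.mulLeft g) _ _ fun h => ?_)
    simp only [Equiv.coe_mulLeft, map_mul, mul_inv, Units.val_mul]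
    ring

theorem sum_character_inv_apply [IsAlgClosed k] [CharZero k] [Fintype (Γ →* kˣ)] [DecidableEq Γ]
    (h : Γ) :
    ∑ γ : Γ →* kˣ, ((γ h)⁻¹ : kˣ).val = if h = 1 then (Fintype.card Γ : k) else 0 := by
  have : NeZero (Monoid.exponent Γ) := ⟨Monoid.exponent_ne_zero_of_finite⟩
  split_ifs with h1
  · obtain ⟨e⟩ := CommGroup.monoidHom_mulEquiv_of_hasEnoughRootsOfUnity Γ k
    simp [h1, Fintype.card_congr e.toEquiv]
  · obtain ⟨δ, hδ⟩ := CommGroup.exists_apply_ne_one_of_hasEnoughRootsOfUnity Γ k h1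
    have hδ' : ((δ h)⁻¹ : kˣ).val ≠ 1 := fun h' => hδ (inv_eq_one.mp (Units.ext h'))
    refine (mul_eq_zero.mp ?_).resolve_left (sub_ne_zero.mpr hδ')
    rw [sub_mul, one_mul, Finset.mul_sum, sub_eq_zero]
    refine (Fintype.sum_equiv (Equiv.mulLeft δ) _ _ fun γ => ?_)
    simp [mul_comm]

end Characters

namespace Lifting

section Idempotents

variable {k : Type*} [Field k] {Γ : Type*} [CommGroup Γ] [Fintype Γ] {t : ℕ}
  {V : QuantumLinearSpace k Γ t} {A : Type*} [Ring A] [HopfAlgebra k A] (L : Lifting V A)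

/-- The idempotent `e_γ = |Γ|⁻¹ ∑ γ(h)⁻¹ h` of `k[Γ] ⊆ A` that projects onto the weight space of
`γ`. -/
noncomputable def idem (γ : Γ →* kˣ) : A :=
  (Fintype.card Γ : k)⁻¹ • ∑ h, ((γ h)⁻¹ : kˣ).val • L.grp h

theorem grp_mul_idem (γ : Γ →* kˣ) (g : Γ) : L.grp g * L.idem γ = (γ g : k) • L.idem γ := by
  rw [idem, mul_smul_comm, smul_comm (γ g : k), Finset.mul_sum]
  congr 1
  rw [Finset.smul_sum (r := (γ g : k))]
  refine Fintype.sum_equiv (Equiv.mulLeft g) _ _ fun h => ?_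
  rw [Equiv.coe_mulLeft, map_mul, map_mul, mul_inv, Units.val_mul, mul_smul_comm, smul_smul,
    ← mul_assoc, Units.mul_inv, one_mul]

/-- If `e_γ ∉ m`, then the class of `e_γ` in `A / m` is a weight vector of weight `γ`. -/
theorem exists_weight_of_idem_notMem {m : Ideal A} {γ : Γ →* kˣ} (h : L.idem γ ∉ m) :
    ∃ s : A ⧸ m, s ≠ 0 ∧ ∀ g, L.grp g • s = (γ g : k) • s := by
  refine ⟨Submodule.Quotient.mk (L.idem γ), ?_, fun g => ?_⟩
  · rwa [Ne, Submodule.Quotient.mk_eq_zero]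
  · rw [← Submodule.Quotient.mk_smul, smul_eq_mul, L.grp_mul_idem, Submodule.Quotient.mk_smul]

variable [CharZero k]

/-- `idem γ` acts on a vector of weight `δ` as the identity if `γ = δ` and as zero otherwise. -/
theorem idem_smul_of_weight {S : Type*} [AddCommGroup S] [Module k S] [Module A S]
    [IsScalarTower k A S] {δ : Γ →* kˣ} {s : S} (hs : ∀ h, L.grp h • s = (δ h : k) • s)
    (γ : Γ →* kˣ) [Decidable (γ = δ)] : L.idem γ • s = if γ = δ then s else 0 := by
  have hc : (Fintype.card Γ : k) ≠ 0 := Nat.cast_ne_zero.mpr Fintype.card_ne_zero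
  simp only [idem, smul_assoc, Finset.sum_smul, hs]
  simp only [smul_smul, ← Finset.sum_smul]
  rw [sum_character_inv_mul]
  split_ifs
  · rw [inv_mul_cancel₀ hc, one_smul]
  · rw [mul_zero, zero_smul]

theorem idem_mul_self (γ : Γ →* kˣ) : L.idem γ * L.idem γ = L.idem γ := by
  classical
  simpa using L.idem_smul_of_weight (S := A) (L.grp_mul_idem γ) γ

theorem idem_ne_zero (γ : Γ →* kˣ) : L.idem γ ≠ 0 := by
  have hc : (Fintype.card Γ : k)⁻¹ ≠ 0 :=
    inv_ne_zero (Nat.cast_ne_zero.mpr Fintype.card_ne_zero)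
  intro h
  have h1 := (smul_eq_zero.mp h).resolve_left hc
  exact Units.ne_zero _ (Fintype.linearIndependent_iff.mp L.linearIndependent_grp _ h1 1)

theorem sum_idem [IsAlgClosed k] [Fintype (Γ →* kˣ)] : ∑ γ, L.idem γ = 1 := by
  classical
  have hc : (Fintype.card Γ : k) ≠ 0 := Nat.cast_ne_zero.mpr Fintype.card_ne_zero
  simp only [idem, ← Finset.smul_sum]
  rw [Finset.sum_comm]
  simp only [← Finset.sum_smul, sum_character_inv_apply]
  simp [hc]

/-- A nonzero idempotent is not in the Jacobson radical, hence each character is a weight of some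
simple module. -/
theorem exists_isMaximal_idem_notMem (γ : Γ →* kˣ) :
    ∃ m : Ideal A, m.IsMaximal ∧ L.idem γ ∉ m := by
  by_contra! h
  have hJ : L.idem γ ∈ Ideal.jacobson (⊥ : Ideal A) := by
    rw [Ideal.jacobson_bot, Ring.jacobson_eq_sInf_isMaximal, Submodule.mem_sInf]
    exact fun m hm => h m hm
  -- `1 - e` has the left inverse `z`, so `e = z (1 - e) e = 0`.
  obtain ⟨z, hz⟩ := Ideal.mem_jacobson_iff.mp hJ (-1)
  rw [Submodule.mem_bot, sub_eq_zero] at hz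
  refine L.idem_ne_zero γ ?_
  rw [← one_mul (L.idem γ), ← hz, add_mul, mul_assoc, L.idem_mul_self]
  simp

theorem exists_weight_quotient [IsAlgClosed k] (m : Ideal A) (hm : m ≠ ⊤) :
    ∃ (γ : Γ →* kˣ) (s : A ⧸ m), s ≠ 0 ∧ ∀ g, L.grp g • s = (γ g : k) • s := by
  have : NeZero (Monoid.exponent Γ) := ⟨Monoid.exponent_ne_zero_of_finite⟩
  obtain ⟨e⟩ := CommGroup.monoidHom_mulEquiv_of_hasEnoughRootsOfUnity Γ k
  have : Fintype (Γ →* kˣ) := Fintype.ofEquiv Γ e.symm.toEquiv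
  have h : ∃ γ, L.idem γ ∉ m := by
    by_contra! h
    refine hm ((Ideal.eq_top_iff_one m).mpr ?_)
    rw [← L.sum_idem]
    exact sum_mem fun γ _ => h γ
  obtain ⟨γ, hγ⟩ := h
  exact ⟨γ, L.exists_weight_of_idem_notMem hγ⟩

end Idempotents

end Lifting

/-! ### Simple modules of a lifting -/

/-- The matrix of the operator `b_0 ↦ b_1 ↦ ⋯ ↦ b_{n-1} ↦ c b_0`. -/
def cyclicMatrix {k : Type*} [Field k] (n : ℕ) (c : k) : Matrix (Fin n) (Fin n) k :=
  .of fun i j => if (i : ℕ) = j + 1 then 1 else if (i : ℕ) = 0 ∧ (j : ℕ) + 1 = n then c else 0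

/-- If the matrix units `e(i, i)` and the cyclic matrix with a nonzero corner entry lie in a
subalgebra of the matrix algebra, then the subalgebra is everything. For `n = 1` the corner entry
does not matter. -/
theorem subalgebra_eq_top_of_cyclicMatrix_mem {k : Type*} [Field k] {n : ℕ} {c : k}
    (hc : n = 1 ∨ c ≠ 0) (B : Subalgebra k (Matrix (Fin n) (Fin n) k))
    (h1 : ∀ i, Matrix.single i i 1 ∈ B) (h2 : cyclicMatrix n c ∈ B) : B = ⊤ := by
  have entry : ∀ i j, cyclicMatrix n c i j ≠ 0 → Matrix.single i j (1 : k) ∈ B := by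
    intro i j hij
    have := B.smul_mem (B.mul_mem (B.mul_mem (h1 i) h2) (h1 j)) (cyclicMatrix n c i j)⁻¹
    rw [Matrix.single_mul_mul_single, Matrix.smul_single] at this
    simpa [hij] using this
  have trans : ∀ i j l, Matrix.single i j (1 : k) ∈ B → Matrix.single j l (1 : k) ∈ B →
      Matrix.single i l (1 : k) ∈ B := by
    intro i j l hij hjl
    have := B.mul_mem hij hjl
    rwa [Matrix.single_mul_single_same, mul_one] at this
  have up : ∀ (m : ℕ) (i j : Fin n), (i : ℕ) = j + m → Matrix.single i j (1 : k) ∈ B := by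
    intro m
    induction m with
    | zero =>
      intro i j h
      obtain rfl : i = j := Fin.ext h
      exact h1 i
    | succ m ih =>
      intro i j h
      refine trans i ⟨j + m, by omega⟩ j (entry _ _ ?_) (ih _ _ rfl)
      simp [cyclicMatrix, h, add_assoc]
  have all : ∀ i j, Matrix.single i j (1 : k) ∈ B := by
    intro i j
    have hn : 0 < n := i.pos
    refine trans i ⟨0, hn⟩ j (up i _ _ (by simp)) (trans _ ⟨n - 1, by omega⟩ _ ?_
      (up (n - 1 - j) _ _ (by simp only; omega)))
    rcases hc with rfl | hc
    · exact h1 _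
    · refine entry _ _ ?_
      have : n - 1 + 1 = n := by omega
      simp [cyclicMatrix, this, hc, hn.ne]
  refine eq_top_iff.mpr fun M _ => ?_
  rw [Matrix.matrix_eq_sum_single M]
  refine B.sum_mem fun i _ => B.sum_mem fun j _ => ?_
  have := B.smul_mem (all i j) (M i j)
  rwa [Matrix.smul_single, smul_eq_mul, mul_one] at this

namespace Lifting

variable {k : Type*} [Field k] {Γ : Type*} [CommGroup Γ] {t : ℕ} [NeZero t]
  {V : QuantumLinearSpace k Γ t} {A : Type*} [Ring A] [HopfAlgebra k A] {L : Lifting V A}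

/-- `ρ` is the matrix representation of `A` in a basis `s, x_0 s, …, x_0^{n-1} s`, where `s` has
weight `γ`, the element `x_0 ^ n` acts as `γ(g_0 ^ r_0) - 1`, and all `x_j` with `j ≠ 0` act as
zero. -/
structure IsCyclicRep (L : Lifting V A) (γ : Γ →* kˣ) {n : ℕ}
    (ρ : A →ₐ[k] Matrix (Fin n) (Fin n) k) : Prop where
  grp : ∀ h, ρ (L.grp h) = Matrix.diagonal fun i : Fin n => ((γ * V.χ 0 ^ (i : ℕ)) h : k)
  x_zero : ρ (L.x 0) = cyclicMatrix n ((γ (V.g 0 ^ V.r 0) : k) - 1)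
  x_ne : ∀ j, j ≠ 0 → ρ (L.x j) = 0

theorem IsCyclicRep.unique [IsAlgClosed k] [FiniteDimensional k A] {γ : Γ →* kˣ} {n : ℕ}
    {ρ ρ' : A →ₐ[k] Matrix (Fin n) (Fin n) k} (h : L.IsCyclicRep γ ρ) (h' : L.IsCyclicRep γ ρ') :
    ρ = ρ' := by
  refine L.algHom_ext (fun g => (h.grp g).trans (h'.grp g).symm) fun j => ?_
  by_cases hj : j = 0
  · rw [hj, h.x_zero, h'.x_zero]
  · rw [h.x_ne j hj, h'.x_ne j hj]

theorem IsCyclicRep.idem [Fintype Γ] [CharZero k] {γ : Γ →* kˣ} {n : ℕ}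
    {ρ : A →ₐ[k] Matrix (Fin n) (Fin n) k} (h : L.IsCyclicRep γ ρ) (δ : Γ →* kˣ)
    [∀ i : ℕ, Decidable (δ = γ * V.χ 0 ^ i)] :
    ρ (L.idem δ) = Matrix.diagonal fun i : Fin n => if δ = γ * V.χ 0 ^ (i : ℕ) then 1 else 0 := by
  have hc : (Fintype.card Γ : k) ≠ 0 := Nat.cast_ne_zero.mpr Fintype.card_ne_zero
  simp only [Lifting.idem, map_smul, map_sum, h.grp]
  ext i j
  rw [Matrix.smul_apply, Matrix.sum_apply]
  by_cases hij : i = j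
  · subst hij
    simp only [Matrix.smul_apply, Matrix.diagonal_apply_eq, smul_eq_mul]
    rw [sum_character_inv_mul]
    split_ifs
    · exact inv_mul_cancel₀ hc
    · exact mul_zero _
  · simp [hij]

theorem pow_mul_injective_of_lt {γ : Γ →* kˣ} {i j : ℕ} (hi : i < V.r 0) (hj : j < V.r 0)
    (h : γ * V.χ 0 ^ i = γ * V.χ 0 ^ j) : i = j := by
  have h1 := DFunLike.congr_fun (mul_left_cancel h) (V.g 0)
  exact (V.isPrimitiveRoot 0).pow_inj hi hj h1

/-- Translating by powers of `χ_0` does not change the value at `g_0 ^ r_0`. -/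
theorem mul_χ_pow_apply (γ : Γ →* kˣ) (i : ℕ) :
    (γ * V.χ 0 ^ i) (V.g 0 ^ V.r 0) = γ (V.g 0 ^ V.r 0) := by
  rw [MonoidHom.mul_apply, MonoidHom.pow_apply, map_pow (V.χ 0), (V.isPrimitiveRoot 0).pow_eq_one,
    one_pow, mul_one]

theorem IsCyclicRep.surjective [Fintype Γ] [CharZero k] {γ : Γ →* kˣ} {n : ℕ}
    {ρ : A →ₐ[k] Matrix (Fin n) (Fin n) k} (h : L.IsCyclicRep γ ρ) (hn : n ≤ V.r 0)
    (hc : n = 1 ∨ γ (V.g 0 ^ V.r 0) ≠ 1) : Function.Surjective ρ := by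
  classical
  rw [← AlgHom.range_eq_top]
  refine subalgebra_eq_top_of_cyclicMatrix_mem (c := (γ (V.g 0 ^ V.r 0) : k) - 1)
    (hc.imp_right fun hc h' => hc (Units.ext (sub_eq_zero.mp h'))) _ (fun i => ?_)
    ⟨L.x 0, h.x_zero⟩
  refine ⟨L.idem (γ * V.χ 0 ^ (i : ℕ)), ?_⟩
  change ρ _ = _
  rw [h.idem, ← Matrix.diagonal_single]
  congr 1
  ext j
  rw [Pi.single_apply]
  congr 1
  refine propext ⟨fun h' => ?_, fun h' => by rw [h']⟩
  exact (Fin.ext (pow_mul_injective_of_lt (i.2.trans_le hn) (j.2.trans_le hn) h')).symm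

theorem grp_smul_pow_smul {S : Type*} [AddCommGroup S] [Module k S]
    [Module A S] [IsScalarTower k A S] {γ : Γ →* kˣ} {s : S}
    (hs : ∀ h, L.grp h • s = (γ h : k) • s) (i : ℕ) (h : Γ) :
    L.grp h • L.x 0 ^ i • s = ((γ * V.χ 0 ^ i) h : k) • L.x 0 ^ i • s := by
  induction i with
  | zero => simpa using hs h
  | succ i ih =>
    rw [pow_succ' (L.x 0), mul_smul, ← mul_smul (L.grp h), L.grp_mul_x, smul_assoc, mul_smul, ih,
      smul_comm (L.x 0), smul_smul]
    congr 1
    simp [pow_succ]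
    ring

section Simple

variable (hL : L.HasMatrix (Matrix.single 0 0 1))
include hL

theorem x_zero_pow : L.x 0 ^ V.r 0 = L.grp (V.g 0 ^ V.r 0) - 1 := by
  simpa using hL.x_pow 0

theorem x_pow_of_ne {j : Fin t} (hj : j ≠ 0) : L.x j ^ V.r j = 0 := by
  simpa [Ne.symm hj] using hL.x_pow j

theorem x_mul_x {i j : Fin t} (hij : i ≠ j) :
    L.x i * L.x j = (V.χ j (V.g i) : k) • (L.x j * L.x i) := by
  have h := hL.x_mul_x i j hij
  rwa [Matrix.single_apply_of_ne, zero_smul, add_zero] at h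
  rintro ⟨rfl, rfl⟩
  exact hij rfl

theorem χ_pow_r : V.χ 0 ^ V.r 0 = 1 := by
  by_contra h
  simpa using hL.diag_eq_zero 0 (.inr h)

theorem x_zero_pow_smul {S : Type*} [AddCommGroup S] [Module k S]
    [Module A S] {γ : Γ →* kˣ} {s : S} (hs : ∀ h, L.grp h • s = (γ h : k) • s) :
    L.x 0 ^ V.r 0 • s = ((γ (V.g 0 ^ V.r 0) : k) - 1) • s := by
  rw [x_zero_pow hL, sub_smul, hs, one_smul, sub_smul, one_smul]

variable [IsAlgClosed k] [FiniteDimensional k A] {S : Type*} [AddCommGroup S] [Module k S]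
  [Module A S] [IsScalarTower k A S] [IsSimpleModule A S]

/-- If some `x_j` is not injective on a simple module, then it acts as zero: its kernel is a
submodule, as `x_j` commutes up to scalars with the generators. -/
theorem x_smul_eq_zero_of_smul_eq_zero {j : Fin t} {s₀ : S} (h0 : s₀ ≠ 0) (hs₀ : L.x j • s₀ = 0)
    (s : S) : L.x j • s = 0 := by
  let W : Submodule k S := LinearMap.ker (Algebra.lsmul k k S (L.x j))
  have hW : W = ⊤ := by
    refine L.eq_top_of_stable (fun h => h0 ?_) (fun h s hs => ?_) fun i s hs => ?_
    · have : s₀ ∈ W := hs₀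
      rwa [h, Submodule.mem_bot] at this
    · change L.x j • s = 0 at hs
      change L.x j • L.grp h • s = 0
      have h1 : L.grp h • L.x j • s = (V.χ j h : k) • (L.x j • L.grp h • s) := by
        rw [← mul_smul, L.grp_mul_x, smul_assoc, mul_smul]
      rw [hs, smul_zero] at h1
      exact (smul_eq_zero.mp h1.symm).resolve_left (Units.ne_zero _)
    · change L.x j • s = 0 at hs
      change L.x j • L.x i • s = 0
      by_cases hij : j = i
      · rw [← hij, hs, smul_zero]
      · rw [← mul_smul, x_mul_x hL hij, smul_assoc, mul_smul, hs, smul_zero, smul_zero]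
  have : s ∈ W := hW ▸ Submodule.mem_top
  exact this

theorem x_smul_eq_zero_of_pow_smul_eq_zero {j : Fin t} {s₀ : S} (h0 : s₀ ≠ 0) {n : ℕ}
    (hs₀ : L.x j ^ n • s₀ = 0) (s : S) : L.x j • s = 0 := by
  induction n with
  | zero => exact absurd (by simpa using hs₀) h0
  | succ n ih =>
    by_cases h : L.x j ^ n • s₀ = 0
    · exact ih h
    · rw [pow_succ', mul_smul] at hs₀
      exact x_smul_eq_zero_of_smul_eq_zero hL h hs₀ s

theorem x_ne_smul_eq_zero {j : Fin t} (hj : j ≠ 0) (s : S) : L.x j • s = 0 := by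
  have := IsSimpleModule.nontrivial A S
  obtain ⟨s₀, h0⟩ := exists_ne (0 : S)
  exact x_smul_eq_zero_of_pow_smul_eq_zero hL h0 (n := V.r j)
    (by rw [x_pow_of_ne hL hj, zero_smul]) s

/-- If `γ(g_0 ^ r_0) ≠ 1`, then `x_0` is injective on each simple module of weight `γ`. -/
theorem x_zero_pow_smul_ne_zero {γ : Γ →* kˣ} (hγ : γ (V.g 0 ^ V.r 0) ≠ 1) {s : S} (h0 : s ≠ 0)
    (hs : ∀ h, L.grp h • s = (γ h : k) • s) (i : ℕ) : L.x 0 ^ i • s ≠ 0 := by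
  intro h
  have hx := x_smul_eq_zero_of_pow_smul_eq_zero hL h0 h
  have h1 := x_zero_pow_smul hL hs
  obtain ⟨r, hr⟩ := Nat.exists_eq_succ_of_ne_zero (Nat.ne_zero_of_lt (V.one_lt_r 0))
  rw [hr, pow_succ', mul_smul, hx] at h1
  rcases smul_eq_zero.mp h1.symm with h2 | h2
  · exact hγ (Units.ext (by rw [hr]; exact sub_eq_zero.mp h2))
  · exact h0 h2

/-- A simple module with a weight vector `s` has the basis `s, x_0 s, …, x_0^{n-1} s`, as soon as
these vectors do not vanish and `x_0 ^ n` acts on `s` as the expected scalar. -/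
theorem exists_isCyclicRep_of_weight {γ : Γ →* kˣ} {s : S}
    (hs : ∀ h, L.grp h • s = (γ h : k) • s) {n : ℕ} (hn0 : n ≠ 0) (hn : n ≤ V.r 0)
    (hne : ∀ i < n, L.x 0 ^ i • s ≠ 0)
    (hxn : L.x 0 ^ n • s = ((γ (V.g 0 ^ V.r 0) : k) - 1) • s) :
    ∃ ρ : A →ₐ[k] Matrix (Fin n) (Fin n) k, L.IsCyclicRep γ ρ ∧
      ∀ a, ρ a = 0 ↔ ∀ u : S, a • u = 0 := by
  have hind : LinearIndependent k fun i : Fin n => L.x 0 ^ (i : ℕ) • s := by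
    refine Module.End.eigenvectors_linearIndependent' (Algebra.lsmul k k S (L.grp (V.g 0)))
      (fun i : Fin n => ((γ * V.χ 0 ^ (i : ℕ)) (V.g 0) : k)) (fun i j hij => ?_) _ fun i => ?_
    · have h1 : (γ * V.χ 0 ^ (i : ℕ)) (V.g 0) = (γ * V.χ 0 ^ (j : ℕ)) (V.g 0) := Units.ext hij
      rw [MonoidHom.mul_apply, MonoidHom.mul_apply] at h1
      exact Fin.ext ((V.isPrimitiveRoot 0).pow_inj (i.2.trans_le hn) (j.2.trans_le hn)
        (mul_left_cancel h1))
    · exact ⟨Module.End.mem_eigenspace_iff.mpr (grp_smul_pow_smul hs i _), hne i i.2⟩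
  have hspan : Submodule.span k (Set.range fun i : Fin n => L.x 0 ^ (i : ℕ) • s) = ⊤ := by
    have stable : ∀ a : A, (∀ i : Fin n, a • L.x 0 ^ (i : ℕ) • s ∈
        Submodule.span k (Set.range fun i : Fin n => L.x 0 ^ (i : ℕ) • s)) →
        ∀ u ∈ Submodule.span k (Set.range fun i : Fin n => L.x 0 ^ (i : ℕ) • s),
        a • u ∈ Submodule.span k (Set.range fun i : Fin n => L.x 0 ^ (i : ℕ) • s) := by
      intro a ha
      change _ ≤ (Submodule.span k _).comap (Algebra.lsmul k k S a)
      rw [Submodule.span_le]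
      rintro _ ⟨i, rfl⟩
      exact ha i
    have hmem : ∀ i : Fin n, L.x 0 ^ (i : ℕ) • s ∈
        Submodule.span k (Set.range fun i : Fin n => L.x 0 ^ (i : ℕ) • s) :=
      fun i => Submodule.subset_span ⟨i, rfl⟩
    refine L.eq_top_of_stable ?_ (fun h => stable _ fun i => ?_) fun j => stable _ fun i => ?_
    · intro h
      have := hmem ⟨0, Nat.pos_of_ne_zero hn0⟩
      rw [h, Submodule.mem_bot] at this
      exact hne 0 (Nat.pos_of_ne_zero hn0) this
    · rw [grp_smul_pow_smul hs]
      exact Submodule.smul_mem _ _ (hmem i)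
    · by_cases hj : j = 0
      · rw [hj, ← mul_smul, ← pow_succ']
        by_cases hi : (i : ℕ) + 1 < n
        · exact hmem ⟨i + 1, hi⟩
        · rw [show (i : ℕ) + 1 = n by omega, hxn]
          have := hmem ⟨0, Nat.pos_of_ne_zero hn0⟩
          rw [pow_zero, one_smul] at this
          exact Submodule.smul_mem _ _ this
      · rw [x_ne_smul_eq_zero hL hj]
        exact Submodule.zero_mem _
  let b : Module.Basis (Fin n) k S := .mk hind hspan.ge
  have hb : ∀ i : Fin n, b i = L.x 0 ^ (i : ℕ) • s := fun i => Module.Basis.mk_apply _ _ i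
  let ρ : A →ₐ[k] Matrix (Fin n) (Fin n) k :=
    (LinearMap.toMatrixAlgEquiv b).toAlgHom.comp (Algebra.lsmul k k S)
  have hρ : ∀ a i j, ρ a i j = b.repr (a • b j) i := fun a i j =>
    LinearMap.toMatrixAlgEquiv_apply b _ i j
  refine ⟨ρ, ⟨fun h => ?_, ?_, fun j hj => ?_⟩, fun a => ?_⟩
  · ext i j
    rw [hρ, hb, grp_smul_pow_smul hs, ← hb, map_smul, b.repr_self, Finsupp.smul_apply,
      Matrix.diagonal_apply, Finsupp.single_apply]
    by_cases hij : i = j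
    · simp [hij]
    · simp [hij, Ne.symm hij]
  · ext i j
    rw [hρ, hb, ← mul_smul, ← pow_succ']
    simp only [cyclicMatrix, Matrix.of_apply]
    by_cases hj : (j : ℕ) + 1 < n
    · rw [← hb ⟨j + 1, hj⟩, b.repr_self, Finsupp.single_apply]
      simp only [Fin.ext_iff, eq_comm (a := (j : ℕ) + 1)]
      split_ifs
      · rfl
      · omega
      · rfl
    · have hj' : (j : ℕ) + 1 = n := by omega
      have h0 : s = b ⟨0, Nat.pos_of_ne_zero hn0⟩ := by rw [hb, pow_zero, one_smul]
      rw [hj', hxn, h0, map_smul, b.repr_self, Finsupp.smul_apply, Finsupp.single_apply,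
        if_neg (by omega : ¬ (i : ℕ) = n)]
      simp only [Fin.ext_iff, eq_comm (a := 0), and_true, smul_eq_mul, mul_ite, mul_one, mul_zero]
  · ext i j'
    rw [hρ, x_ne_smul_eq_zero hL hj]
    simp
  · have h1 : ρ a = 0 ↔ Algebra.lsmul k k S a = 0 :=
      map_eq_zero_iff _ (LinearMap.toMatrixAlgEquiv b).injective
    rw [h1]
    exact ⟨fun h u => LinearMap.congr_fun h u, fun h => LinearMap.ext h⟩

/-- The simple modules with a weight `γ ∈ Ω` are one-dimensional. -/
theorem exists_isCyclicRep_one {γ : Γ →* kˣ} (hγ : γ (V.g 0 ^ V.r 0) = 1) {s : S} (h0 : s ≠ 0)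
    (hs : ∀ h, L.grp h • s = (γ h : k) • s) :
    ∃ ρ : A →ₐ[k] Matrix (Fin 1) (Fin 1) k, L.IsCyclicRep γ ρ ∧
      ∀ a, ρ a = 0 ↔ ∀ u : S, a • u = 0 := by
  refine exists_isCyclicRep_of_weight hL hs one_ne_zero (V.one_lt_r 0).le (fun i hi => ?_) ?_
  · rwa [Nat.lt_one_iff.mp hi, pow_zero, one_smul]
  · have h := x_zero_pow_smul hL hs
    rw [hγ, Units.val_one, sub_self, zero_smul] at h ⊢
    rw [pow_one]
    exact x_smul_eq_zero_of_pow_smul_eq_zero hL h0 h s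

/-- The simple modules with a weight `γ ∉ Ω` have dimension `r_0`. -/
theorem exists_isCyclicRep_r {γ : Γ →* kˣ} (hγ : γ (V.g 0 ^ V.r 0) ≠ 1) {s : S} (h0 : s ≠ 0)
    (hs : ∀ h, L.grp h • s = (γ h : k) • s) :
    ∃ ρ : A →ₐ[k] Matrix (Fin (V.r 0)) (Fin (V.r 0)) k, L.IsCyclicRep γ ρ ∧
      ∀ a, ρ a = 0 ↔ ∀ u : S, a • u = 0 :=
  exists_isCyclicRep_of_weight hL hs (Nat.ne_zero_of_lt (V.one_lt_r 0)) le_rfl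
    (fun i _ => x_zero_pow_smul_ne_zero hL hγ h0 hs i) (x_zero_pow_smul hL hs)

end Simple

end Lifting

/-! ### Coalgebra maps out of direct sums and group algebras -/

section CoalgHoms

variable {k : Type*} [Field k] {B C D : Type*} [AddCommGroup B] [Module k B] [Coalgebra k B]
  [AddCommGroup C] [Module k C] [Coalgebra k C] [AddCommGroup D] [Module k D] [Coalgebra k D]

/-- The coalgebra map out of a direct sum of two coalgebras given by its components. -/
noncomputable def CoalgHom.coprod (f : B →ₗc[k] D) (g : C →ₗc[k] D) : B × C →ₗc[k] D where
  toLinearMap := f.toLinearMap.coprod g.toLinearMap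
  counit_comp := by
    apply LinearMap.prod_ext
    · rw [LinearMap.comp_assoc, LinearMap.coprod_inl, f.counit_comp]
      ext x; simp
    · rw [LinearMap.comp_assoc, LinearMap.coprod_inr, g.counit_comp]
      ext x; simp
  map_comp_comul := by
    apply LinearMap.prod_ext
    · rw [LinearMap.comp_assoc, LinearMap.comp_assoc, LinearMap.coprod_inl, ← f.map_comp_comul,
        Prod.comul_comp_inl, ← LinearMap.comp_assoc, ← TensorProduct.map_comp,
        LinearMap.coprod_inl]
    · rw [LinearMap.comp_assoc, LinearMap.comp_assoc, LinearMap.coprod_inr, ← g.map_comp_comul,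
        Prod.comul_comp_inr, ← LinearMap.comp_assoc, ← TensorProduct.map_comp,
        LinearMap.coprod_inr]

/-- The coalgebra map out of a direct sum of copies of a coalgebra given by its components. -/
noncomputable def CoalgHom.finsuppLsum {ι : Type*} (f : ι → C →ₗc[k] D) : (ι →₀ C) →ₗc[k] D where
  toLinearMap := Finsupp.lsum k fun i => (f i).toLinearMap
  counit_comp := by
    refine Finsupp.lhom_ext' fun i => ?_
    rw [LinearMap.comp_assoc, Finsupp.lsum_comp_lsingle, (f i).counit_comp,
      Finsupp.counit_comp_lsingle]
  map_comp_comul := by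
    refine Finsupp.lhom_ext' fun i => ?_
    rw [LinearMap.comp_assoc, LinearMap.comp_assoc, Finsupp.lsum_comp_lsingle,
      ← (f i).map_comp_comul, Finsupp.comul_comp_lsingle, ← LinearMap.comp_assoc,
      ← TensorProduct.map_comp, Finsupp.lsum_comp_lsingle]

/-- The coalgebra map out of a group algebra given by a family of grouplike elements. -/
noncomputable def CoalgHom.ofGroupLike {G : Type*} (f : G → D) (hf : ∀ g, IsGroupLikeElem k (f g)) :
    MonoidAlgebra k G →ₗc[k] D where
  toLinearMap := Finsupp.linearCombination k f ∘ₗ (MonoidAlgebra.coeffLinearEquiv k).toLinearMap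
  counit_comp := by
    refine MonoidAlgebra.lhom_ext' fun g => LinearMap.ext_ring ?_
    simp [(hf g).counit_eq_one]
  map_comp_comul := by
    refine MonoidAlgebra.lhom_ext' fun g => LinearMap.ext_ring ?_
    simp [(hf g).comul_eq_tmul_self]

theorem CoalgHom.range_ofGroupLike {G : Type*} (f : G → D) (hf : ∀ g, IsGroupLikeElem k (f g)) :
    LinearMap.range (CoalgHom.ofGroupLike f hf).toLinearMap = ⨆ g, Submodule.span k {f g} := by
  change LinearMap.range (Finsupp.linearCombination k f ∘ₗ
    (MonoidAlgebra.coeffLinearEquiv k).toLinearMap) = _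
  rw [LinearEquiv.range_comp, Finsupp.range_linearCombination, Submodule.span_range_eq_iSup]

theorem CoalgHom.range_finsuppLsum {ι : Type*} (f : ι → C →ₗc[k] D) :
    LinearMap.range (CoalgHom.finsuppLsum f).toLinearMap =
      ⨆ i, LinearMap.range (f i).toLinearMap := by
  apply le_antisymm
  · rintro _ ⟨w, rfl⟩
    exact sum_mem fun i _ => Submodule.mem_iSup_of_mem i ⟨w i, rfl⟩
  · refine iSup_le fun i => ?_
    rintro _ ⟨c, rfl⟩
    exact ⟨Finsupp.single i c, Finsupp.lsum_single k _ i c⟩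

theorem CoalgHom.range_coprod (f : B →ₗc[k] D) (g : C →ₗc[k] D) :
    LinearMap.range (CoalgHom.coprod f g).toLinearMap =
      LinearMap.range f.toLinearMap ⊔ LinearMap.range g.toLinearMap :=
  LinearMap.range_coprod _ _

end CoalgHoms

/-! ### The coradical of the dual -/

section

variable {k : Type*} [Field k] {R : Type*} [Ring R] [Algebra k R] [FiniteDimensional k R]

/-- A simple subcoalgebra `D` of `R^*` is spanned by the matrix coefficients of any simple module
that is annihilated by the ideal of `R` orthogonal to `D`. -/
theorem IsSimpleSubcoalgebra.eq_range_matrixCoeffHom {D : Submodule k (Module.Dual k R)}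
    (hD : IsSimpleSubcoalgebra k (Module.Dual k R) D) {m : Ideal R}
    (hm : ∀ a ∈ hD.1.ideal, a ∈ m) {d : ℕ} (hd : d ≠ 0) {ρ : R →ₐ[k] Matrix (Fin d) (Fin d) k}
    (hρ : Function.Surjective ρ) (hker : ∀ a, ρ a = 0 ↔ ∀ u : R ⧸ m, a • u = 0) :
    LinearMap.range (matrixCoeffHom ρ).toLinearMap = D := by
  obtain ⟨h1, h2, -⟩ := isSimpleSubcoalgebra_range_matrixCoeffHom hd hρ
  refine (hD.2.2 _ h1 (le_of_dualCoannihilator_le fun a ha => ?_)).resolve_left h2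
  rw [Submodule.mem_dualCoannihilator] at ha ⊢
  refine fun f hf => (mem_range_matrixCoeffHom hρ).mp hf a ((hker a).mpr fun u => ?_)
  obtain ⟨b, rfl⟩ := Submodule.Quotient.mk_surjective m u
  rw [← Submodule.Quotient.mk_smul, Submodule.Quotient.mk_eq_zero]
  exact hm _ (TwoSidedIdeal.mul_mem_right _ _ b (hD.1.mem_ideal.mpr ha))

theorem IsSimpleSubcoalgebra.exists_isMaximal {D : Submodule k (Module.Dual k R)}
    (hD : IsSimpleSubcoalgebra k (Module.Dual k R) D) :
    ∃ m : Ideal R, m.IsMaximal ∧ ∀ a ∈ hD.1.ideal, a ∈ m := by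
  obtain ⟨m, hm, hle⟩ := Ideal.exists_le_maximal (TwoSidedIdeal.asIdeal hD.1.ideal) (by
    rw [Ne, Ideal.eq_top_iff_one, TwoSidedIdeal.mem_asIdeal]
    intro h
    refine hD.2.1 (eq_bot_iff.mpr fun f hf => (Submodule.mem_bot k).mpr (LinearMap.ext fun b => ?_))
    have := hD.1.mem_ideal.mp (TwoSidedIdeal.mul_mem_right _ _ b h) f hf
    rwa [one_mul] at this)
  exact ⟨m, hm, fun a ha => hle (TwoSidedIdeal.mem_asIdeal.mpr ha)⟩

theorem isGroupLikeElem_matrixCoeff (ρ : R →ₐ[k] Matrix (Fin 1) (Fin 1) k) :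
    IsGroupLikeElem k (matrixCoeff ρ 0 0) where
  counit_eq_one := by rw [dual_counit_apply]; simp
  comul_eq_tmul_self := by rw [comul_matrixCoeff]; simp

theorem range_matrixCoeffHom_one (ρ : R →ₐ[k] Matrix (Fin 1) (Fin 1) k) :
    LinearMap.range (matrixCoeffHom ρ).toLinearMap = Submodule.span k {matrixCoeff ρ 0 0} := by
  refine (Module.Basis.constr_range (MatrixCoalgebra.basis 1 k) k).trans ?_
  congr 1
  ext f
  simp [eq_comm]

end

namespace Lifting

variable {k : Type*} [Field k] {Γ : Type*} [CommGroup Γ] {t : ℕ} [NeZero t]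
  {V : QuantumLinearSpace k Γ t}

theorem mem_Ω_single {γ : Γ →* kˣ} :
    γ ∈ V.Ω (Matrix.single 0 0 1) ↔ γ (V.g 0 ^ V.r 0) = 1 := by
  constructor
  · intro h
    have := h.1 0
    rw [Matrix.single_apply_same, one_mul] at this
    exact Units.ext (sub_eq_zero.mp this)
  · intro h
    refine ⟨fun i => ?_, fun i j hij => ?_⟩
    · by_cases hi : i = 0
      · rw [hi, h, Units.val_one, sub_self, mul_zero]
      · exact mul_eq_zero_of_left (Matrix.single_apply_of_ne _ _ _ _ _ fun h => hi h.1.symm) _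
    · exact mul_eq_zero_of_left
        (Matrix.single_apply_of_ne _ _ _ _ _ fun h => hij (h.1.symm.trans h.2)) _

variable {A : Type*} [Ring A] [HopfAlgebra k A] {L : Lifting V A}

theorem IsCyclicRep.idem_eq_zero [Fintype Γ] [CharZero k] {γ : Γ →* kˣ} {n : ℕ}
    {ρ : A →ₐ[k] Matrix (Fin n) (Fin n) k} (h : L.IsCyclicRep γ ρ) {δ : Γ →* kˣ}
    (hδ : ∀ i < n, δ ≠ γ * V.χ 0 ^ i) : ρ (L.idem δ) = 0 := by
  classical
  rw [h.idem]
  ext i j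
  simp [Matrix.diagonal_apply, hδ i i.2]

/-- The sum of the idempotents of the weights of a cyclic representation acts as the identity. -/
theorem IsCyclicRep.sum_idem [Fintype Γ] [CharZero k] {γ : Γ →* kˣ} {n : ℕ}
    {ρ : A →ₐ[k] Matrix (Fin n) (Fin n) k} (h : L.IsCyclicRep γ ρ) (hn : n ≤ V.r 0) :
    ρ (∑ i : Fin n, L.idem (γ * V.χ 0 ^ (i : ℕ))) = 1 := by
  classical
  rw [map_sum]
  ext i j
  simp only [Matrix.sum_apply, h.idem, Matrix.diagonal_apply, Matrix.one_apply]
  split_ifs with hij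
  · rw [Finset.sum_eq_single i]
    · simp
    · intro l _ hl
      refine if_neg fun h' => hl (Fin.ext ?_)
      exact pow_mul_injective_of_lt (l.2.trans_le hn) (i.2.trans_le hn) h'
    · simp
  · simp

/-- A character in the coset `γ ⟨χ_0⟩` is of the form `γ χ_0 ^ j` with `j` a natural number. -/
theorem exists_eq_mul_χ_pow (hL : L.HasMatrix (Matrix.single 0 0 1)) {γ γ' : Γ →* kˣ}
    (h : (γ' : (Γ →* kˣ) ⧸ Subgroup.zpowers (V.χ 0)) = γ) : ∃ j : ℕ, γ' = γ * V.χ 0 ^ j := by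
  have h1 : γ⁻¹ * γ' ∈ Subgroup.zpowers (V.χ 0) := QuotientGroup.eq.mp h.symm
  have hfin : IsOfFinOrder (V.χ 0) := isOfFinOrder_iff_pow_eq_one.mpr
    ⟨V.r 0, by have := V.one_lt_r 0; omega, χ_pow_r hL⟩
  obtain ⟨j, hj⟩ := hfin.mem_powers_iff_mem_zpowers.mpr h1
  exact ⟨j, by rw [show V.χ 0 ^ j = γ⁻¹ * γ' from hj]; exact (mul_inv_cancel_left γ γ').symm⟩

theorem mul_χ_pow_zero (γ : Γ →* kˣ) : γ * V.χ 0 ^ 0 = γ := by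
  ext
  simp

section Existence

variable [IsAlgClosed k] [CharZero k] [Fintype Γ] [FiniteDimensional k A]
  (hL : L.HasMatrix (Matrix.single 0 0 1))
include hL

theorem exists_isCyclicRep_of_eq_one {γ : Γ →* kˣ} (hγ : γ (V.g 0 ^ V.r 0) = 1) :
    ∃ ρ : A →ₐ[k] Matrix (Fin 1) (Fin 1) k, L.IsCyclicRep γ ρ := by
  obtain ⟨m, hm, hγm⟩ := L.exists_isMaximal_idem_notMem γ
  have : IsSimpleModule A (A ⧸ m) := isSimpleModule_iff_isCoatom.mpr hm.out
  obtain ⟨s, h0, hs⟩ := L.exists_weight_of_idem_notMem hγm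
  exact (exists_isCyclicRep_one hL hγ h0 hs).imp fun _ h => h.1

theorem exists_isCyclicRep_of_ne_one {γ : Γ →* kˣ} (hγ : γ (V.g 0 ^ V.r 0) ≠ 1) :
    ∃ ρ : A →ₐ[k] Matrix (Fin (V.r 0)) (Fin (V.r 0)) k, L.IsCyclicRep γ ρ := by
  obtain ⟨m, hm, hγm⟩ := L.exists_isMaximal_idem_notMem γ
  have : IsSimpleModule A (A ⧸ m) := isSimpleModule_iff_isCoatom.mpr hm.out
  obtain ⟨s, h0, hs⟩ := L.exists_weight_of_idem_notMem hγm
  exact (exists_isCyclicRep_r hL hγ h0 hs).imp fun _ h => h.1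

/-- The simple subcoalgebras of `A^*` are the coefficient spaces of the cyclic representations,
with one representation for each character in `Ω` and for each coset outside of `Ω`. -/
theorem isSimpleSubcoalgebra_cases {D : Submodule k (Module.Dual k A)}
    (hD : IsSimpleSubcoalgebra k (Module.Dual k A) D) :
    (∃ γ : Γ →* kˣ, γ (V.g 0 ^ V.r 0) = 1 ∧
      ∀ ρ : A →ₐ[k] Matrix (Fin 1) (Fin 1) k, L.IsCyclicRep γ ρ →
        LinearMap.range (matrixCoeffHom ρ).toLinearMap = D) ∨
    ∃ γ : Γ →* kˣ, γ (V.g 0 ^ V.r 0) ≠ 1 ∧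
      ∀ γ' : Γ →* kˣ, (γ' : (Γ →* kˣ) ⧸ Subgroup.zpowers (V.χ 0)) = γ →
        ∀ ρ : A →ₐ[k] Matrix (Fin (V.r 0)) (Fin (V.r 0)) k, L.IsCyclicRep γ' ρ →
          LinearMap.range (matrixCoeffHom ρ).toLinearMap = D := by
  obtain ⟨m, hm, hDm⟩ := hD.exists_isMaximal
  have : IsSimpleModule A (A ⧸ m) := isSimpleModule_iff_isCoatom.mpr hm.out
  obtain ⟨γ, s, h0, hs⟩ := L.exists_weight_quotient m hm.ne_top
  by_cases hγ : γ (V.g 0 ^ V.r 0) = 1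
  · refine .inl ⟨γ, hγ, fun ρ hρ => ?_⟩
    obtain ⟨ρ', hρ', hker⟩ := exists_isCyclicRep_one hL hγ h0 hs
    obtain rfl := hρ'.unique hρ
    exact hD.eq_range_matrixCoeffHom hDm one_ne_zero
      (hρ.surjective (V.one_lt_r 0).le (.inl rfl)) hker
  · refine .inr ⟨γ, hγ, fun γ' hγγ' ρ hρ => ?_⟩
    obtain ⟨j, rfl⟩ := exists_eq_mul_χ_pow hL hγγ'
    have hγ' : (γ * V.χ 0 ^ j) (V.g 0 ^ V.r 0) ≠ 1 := by rwa [mul_χ_pow_apply]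
    obtain ⟨ρ', hρ', hker⟩ := exists_isCyclicRep_r hL hγ'
      (x_zero_pow_smul_ne_zero hL hγ h0 hs j) (grp_smul_pow_smul hs j)
    obtain rfl := hρ'.unique hρ
    exact hD.eq_range_matrixCoeffHom hDm (Nat.ne_zero_of_lt (V.one_lt_r 0))
      (hρ.surjective le_rfl (.inr hγ')) hker

end Existence

section Sum

variable [FiniteDimensional k A] {G I : Type*}
  {lam : G → A →ₐ[k] Matrix (Fin 1) (Fin 1) k}
  {ρ : I → A →ₐ[k] Matrix (Fin (V.r 0)) (Fin (V.r 0)) k}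

/-- The sum of the coefficient maps of a family of one-dimensional representations and of a family
of `r_0`-dimensional representations. -/
noncomputable def coeffSum (lam : G → A →ₐ[k] Matrix (Fin 1) (Fin 1) k)
    (ρ : I → A →ₐ[k] Matrix (Fin (V.r 0)) (Fin (V.r 0)) k) :
    MonoidAlgebra k G × (I →₀ MatrixCoalgebra (V.r 0) k) →ₗc[k] Module.Dual k A :=
  .coprod (.ofGroupLike (fun γ => matrixCoeff (lam γ) 0 0)
    fun γ => isGroupLikeElem_matrixCoeff (lam γ)) (.finsuppLsum fun c => matrixCoeffHom (ρ c))

theorem coeffSum_apply (u : MonoidAlgebra k G) (w : I →₀ MatrixCoalgebra (V.r 0) k) (a : A) :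
    coeffSum lam ρ (u, w) a = (u.coeff.sum fun γ c => c * lam γ a 0 0) +
      w.sum fun c M => matrixCoeffHom (ρ c) M a := by
  change ((u.coeff.sum fun γ c => c • matrixCoeff (lam γ) 0 0) +
    w.sum fun c M => matrixCoeffHom (ρ c) M) a = _
  simp only [Finsupp.sum, LinearMap.add_apply, LinearMap.sum_apply]
  rfl

theorem range_coeffSum : LinearMap.range (coeffSum lam ρ).toLinearMap =
    (⨆ γ, LinearMap.range (matrixCoeffHom (lam γ)).toLinearMap) ⊔
      ⨆ c, LinearMap.range (matrixCoeffHom (ρ c)).toLinearMap := by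
  rw [coeffSum, CoalgHom.range_coprod, CoalgHom.range_ofGroupLike, CoalgHom.range_finsuppLsum]
  simp only [range_matrixCoeffHom_one]

variable [CharZero k] [Fintype Γ] {gG : G → Γ →* kˣ} {gI : I → Γ →* kˣ}

/-- Representations with pairwise disjoint sets of weights have linearly independent matrix
coefficients: the idempotents of the weights of one of them separate it from the others. -/
theorem coeffSum_injective (hlam : ∀ γ, L.IsCyclicRep (gG γ) (lam γ))
    (hρ : ∀ c, L.IsCyclicRep (gI c) (ρ c)) (hsurj : ∀ c, Function.Surjective (ρ c))
    (hG : Function.Injective gG) (hGI : ∀ γ c (i : ℕ), gG γ ≠ gI c * V.χ 0 ^ i)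
    (hI : ∀ c c' (i j : ℕ), gI c * V.χ 0 ^ i = gI c' * V.χ 0 ^ j → c = c') :
    Function.Injective (coeffSum lam ρ) := by
  refine (injective_iff_map_eq_zero (coeffSum lam ρ)).mpr ?_
  rintro ⟨u, w⟩ h
  have happ : ∀ a, (u.coeff.sum fun γ c => c * lam γ a 0 0) +
      (w.sum fun c M => matrixCoeffHom (ρ c) M a) = 0 := fun a => by
    rw [← coeffSum_apply, h, LinearMap.zero_apply]
  have hw : w = 0 := by
    ext1 c
    refine eq_zero_of_sum_repr_mul_eq_zero fun N => ?_
    obtain ⟨b, rfl⟩ := hsurj c N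
    have hsum := happ (b * ∑ i : Fin (V.r 0), L.idem (gI c * V.χ 0 ^ (i : ℕ)))
    have h1 : ∀ γ, lam γ (∑ i : Fin (V.r 0), L.idem (gI c * V.χ 0 ^ (i : ℕ))) = 0 := by
      intro γ
      rw [map_sum]
      refine Finset.sum_eq_zero fun i _ => (hlam γ).idem_eq_zero fun j hj => ?_
      rw [Nat.lt_one_iff.mp hj, mul_χ_pow_zero]
      exact (hGI γ c i).symm
    have h2 : ∀ c', c' ≠ c →
        ρ c' (∑ i : Fin (V.r 0), L.idem (gI c * V.χ 0 ^ (i : ℕ))) = 0 := by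
      intro c' hc'
      rw [map_sum]
      exact Finset.sum_eq_zero fun i _ => (hρ c').idem_eq_zero fun j _ h' =>
        hc' (hI _ _ _ _ h').symm
    rw [Finsupp.sum, Finset.sum_eq_zero, zero_add, Finsupp.sum, Finset.sum_eq_single c] at hsum
    · rwa [matrixCoeffHom_apply, map_mul, (hρ c).sum_idem le_rfl, mul_one] at hsum
    · intro c' _ hc'
      rw [matrixCoeffHom_apply, map_mul, h2 c' hc', mul_zero]
      simp
    · intro hc
      rw [Finsupp.notMem_support_iff.mp hc, map_zero, LinearMap.zero_apply]
    · intro γ _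
      rw [map_mul, h1, mul_zero, Matrix.zero_apply, mul_zero]
  subst hw
  suffices u.coeff = 0 by
    rw [Prod.mk_eq_zero]
    exact ⟨MonoidAlgebra.coeff_injective this, rfl⟩
  ext γ
  have hsum := happ (L.idem (gG γ))
  rw [Finsupp.sum_zero_index, add_zero, Finsupp.sum, Finset.sum_eq_single γ] at hsum
  · have h1 := (hlam γ).sum_idem (V.one_lt_r 0).le
    simp only [Finset.univ_unique, Fin.default_eq_zero, Fin.val_zero, Finset.sum_singleton,
      mul_χ_pow_zero] at h1
    rw [h1] at hsum
    simpa using hsum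
  · intro γ' _ hγ'
    rw [(hlam γ').idem_eq_zero, Matrix.zero_apply, mul_zero]
    intro j hj
    rw [Nat.lt_one_iff.mp hj, mul_χ_pow_zero]
    exact fun h' => hγ' (hG h').symm
  · intro hγ
    rw [Finsupp.notMem_support_iff.mp hγ, zero_mul]

end Sum

end Lifting

/-- Here `Θ` is the subgroup of the character group generated by `χ_1` (index `0`), and the
coradical `C` of `A^*` is described by an injective coalgebra map into `A^*` with image `C`. -/
theorem corollary3p5 {k : Type*} [Field k] [IsAlgClosed k] [CharZero k]
    {Γ : Type*} [CommGroup Γ] [Finite Γ] {t : ℕ} [NeZero t] (V : QuantumLinearSpace k Γ t)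
    {A : Type*} [Ring A] [HopfAlgebra k A] [FiniteDimensional k A] (L : Lifting V A)
    (α : Matrix (Fin t) (Fin t) k) (hα : α = Matrix.single 0 0 1) (hL : L.HasMatrix α) :
    ∃ f : (MonoidAlgebra k (V.Ω α) ×
        ({c : (Γ →* kˣ) ⧸ Subgroup.zpowers (V.χ 0) //
            ∃ γ : Γ →* kˣ, QuotientGroup.mk γ = c ∧ γ ∉ V.Ω α} →₀ MatrixCoalgebra (V.r 0) k))
          →ₗc[k] Module.Dual k A,
      Function.Injective f ∧
        LinearMap.range f.toLinearMap = coradical k (Module.Dual k A) := by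
  subst hα
  have := Fintype.ofFinite Γ
  choose lam hlam using fun γ : V.Ω (Matrix.single 0 0 1) =>
    Lifting.exists_isCyclicRep_of_eq_one hL (Lifting.mem_Ω_single.mp γ.2)
  choose g hg hgΩ using fun c : {c : (Γ →* kˣ) ⧸ Subgroup.zpowers (V.χ 0) //
    ∃ γ : Γ →* kˣ, QuotientGroup.mk γ = c ∧ γ ∉ V.Ω (Matrix.single 0 0 1)} => c.2
  have hg1 : ∀ c, g c (V.g 0 ^ V.r 0) ≠ 1 := fun c h => hgΩ c (Lifting.mem_Ω_single.mpr h)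
  choose ρ hρ using fun c => Lifting.exists_isCyclicRep_of_ne_one hL (hg1 c)
  have hsurj : ∀ c, Function.Surjective (ρ c) := fun c =>
    (hρ c).surjective le_rfl (.inr (hg1 c))
  have hlsurj : ∀ γ, Function.Surjective (lam γ) := fun γ =>
    (hlam γ).surjective (V.one_lt_r 0).le (.inl rfl)
  refine ⟨Lifting.coeffSum lam ρ, Lifting.coeffSum_injective hlam hρ hsurj Subtype.val_injective
    (fun γ c i h => hg1 c ?_) fun c c' i j h => Subtype.ext ?_, ?_⟩
  · rw [← Lifting.mul_χ_pow_apply (g c) i, ← h]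
    exact Lifting.mem_Ω_single.mp γ.2
  · rw [← hg c, ← hg c', QuotientGroup.eq]
    refine Subgroup.mem_zpowers_iff.mpr ⟨(i : ℤ) - j, ?_⟩
    rw [zpow_sub, zpow_natCast, zpow_natCast, mul_inv_eq_iff_eq_mul, mul_assoc, ← h,
      inv_mul_cancel_left]
  rw [Lifting.range_coeffSum]
  apply le_antisymm
  · refine sup_le (iSup_le fun γ => le_sSup ?_) (iSup_le fun c => le_sSup ?_)
    · exact isSimpleSubcoalgebra_range_matrixCoeffHom one_ne_zero (hlsurj γ)
    · exact isSimpleSubcoalgebra_range_matrixCoeffHom (Nat.ne_zero_of_lt (V.one_lt_r 0)) (hsurj c)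
  · refine sSup_le fun D hD => ?_
    rcases Lifting.isSimpleSubcoalgebra_cases hL hD with ⟨γ, hγ, h⟩ | ⟨γ, hγ, h⟩
    · rw [← h _ (hlam ⟨γ, Lifting.mem_Ω_single.mpr hγ⟩)]
      exact le_sup_of_le_left (le_iSup_of_le _ le_rfl)
    · have hγ' : γ ∉ V.Ω (Matrix.single 0 0 1) := fun h' => hγ (Lifting.mem_Ω_single.mp h')
      rw [← h _ (hg ⟨QuotientGroup.mk γ, γ, rfl, hγ'⟩) _ (hρ _)]
      exact le_sup_of_le_right (le_iSup_of_le _ le_rfl)
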